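/- **Setting.** Let $(\rho_k)_{k\ge 1}$ and $(\sigma_k)_{k\ge 2}$ be arbitrary real sequences. For $x\ge 0$ put $$\tilde\rho_k(x)=\rho_k\,{}_2F_1\!\left(\tfrac k2,\tfrac{k+1}2;\tfrac{2k+3}2;-x^2\right),\qquad \tilde\sigma_k(x)=\sigma_k\,{}_2F_1\!\left(\tfrac k2,\tfrac{k+1}2;\tfrac{2k+1}2;-x^2\right),$$ where ${}_2F_1(a,b;c;\cdot)$ is the analytic continuation of the hypergeometric series to $(-\infty,1)$. Let $P^0_l$ be the Legendre polynomials and $P^1_l(\xi)=\sqrt{1-\xi^2}\,\frac{d}{d\xi}P^0_l(\xi)$. With a formal parameter $\ell$ and $r=\ell x$, let $$\alpha=\sum_{k\ge1}\tilde\rho_k(x)P^0_k(\xi)(x\ell)^k,\qquad \omega=\sqrt{1-\xi^2}+\sum_{k\ge2}\tilde\sigma_k(x)P^1_{k-1}(\xi)(x\ell)^k,$$ and let $\hat\eta_j,\hat\zeta_j,\hat G_j,\hat P_j$ (functions of $x$) be the coefficients of $\ell^j$ in $$\eta=\tfrac12\!\int_{-1}^1\!(\partial_r\alpha)^2d\xi,\quad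 \zeta=\tfrac12\!\int_{-1}^1\!\omega^2(\partial_\xi\alpha)^2d\xi,\quad G=\tfrac12\!\int_{-1}^1\!(\partial_r\omega)^2d\xi,\quad P=\tfrac18\!\int_{-1}^1\!\bigl(\partial_\xi(\omega^2+\xi^2)\bigr)^2d\xi .$$ For families $(f_k)_{k\ge2}$, $(g_k)_{k\ge2}$ write $(f\star g)_j=\sum_{k=2}^{j-2}f_kg_{j-k}$ (zero for $j<4$). For families of functions $(\hat m_k)_{k\ge2},(\hat S_k)_{k\ge2}$ let $\widehat{\mathcal M}_j$ and $\widetilde{\mathcal M}_j$, $j\ge2$, be the coefficients of $\ell^j$ in $\mu S^2$ and $\mu^2S$, where $\mu=1+x^2-\frac2x\sum_{k\ge2}\hat m_k\ell^k$ and $S=1+\sum_{k\ge2}\hat S_k\ell^k$, i.e. $$\widehat{\mathcal M}_j=2(1+x^2)\hat S_j-\tfrac2x\bigl(\hat m_j+2(\hat m\star\hat S)_j\bigr)+(1+x^2)(\hat S\star\hat S)_j-\tfrac2x(\hat m\star\hat S\star\hat S)_j,$$ $$\widetilde{\mathcal M}_j=(1+x^2)^2\hat S_j-\tfrac{4(1+x^2)}x\bigl(\hat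 m_j+(\hat m\star\hat S)_j\bigr)+\tfrac4{x^2}\bigl((\hat m\star\hat m)_j+(\hat m\star\hat m\star\hat S)_j\bigr).$$ The Einstein equations $m'=\frac32\bigl(\frac{r^2\eta}{4S^2}+\frac{\zeta}{4\mu S^2}+\mu G+\frac P{r^2}\bigr)$, $\frac{S'}S=\frac2r\bigl(G+\frac{\zeta}{4\mu^2S^2}\bigr)$ with $m=\ell\sum_{k\ge 2}\hat m_k\ell^k$ give at order $\ell^j$, $j\ge2$, the recursive equations on $(0,\infty)$ $$\begin{aligned}\tfrac23\frac{d\hat m_j}{dx}={}&-\frac{2}{3(1+x^2)}\sum_{k=2}^{j-2}\widehat{\mathcal M}_k\frac{d\hat m_{j-k}}{dx}-\frac{x}{2(1+x^2)}\sum_{k=2}^{j-2}\hat m_k\hat\eta_{j-k-2}+\frac{\hat\zeta_j}{4(1+x^2)}+(\widehat{\mathcal M}\star\hat G)_j-\frac2x(\hat m\star\hat G)_j\\&-\frac{2}{x(1+x^2)}(\hat m\star\widehat{\mathcal M}\star\hat G)_j+(1+x^2)\hat G_j+\frac{x^2}4\hat\eta_{j-2}+\frac{\hat P_{j+2}}{x^2}+\frac1{x^2(1+x^2)}\sum_{k=2}^{j-2}\widehat{\mathcal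 M}_k\hat P_{j-k+2},\end{aligned}\tag{1}$$ $$\begin{aligned}\frac{d\hat S_j}{dx}={}&\frac2x\hat G_j+\frac{\hat\zeta_j}{2x(1+x^2)^2}+\frac{2}{x(1+x^2)^2}(\hat G\star\widetilde{\mathcal M})_j+\frac2x(\hat G\star\hat S)_j+\frac2{x(1+x^2)^2}(\hat G\star\hat S\star\widetilde{\mathcal M})_j\\&-\frac1{(1+x^2)^2}\sum_{k=2}^{j-2}\widetilde{\mathcal M}_k\frac{d\hat S_{j-k}}{dx}.\end{aligned}\tag{2}$$ They are complemented by the boundary conditions $\hat m_j(0)=0$ and $\lim_{x\to\infty}\hat S_j(x)=0$. A *solution of order $j$* means: $\hat m_j,\hat S_j$ are continuous on $[0,\infty)$, satisfy (1), (2) on $(0,\infty)$, and satisfy these boundary conditions. **Proposition.** The recursive equations can be solved sequentially, by integration and substitution, to arbitrarily high order, and the solutions are globally regular. Precisely: 1. For $j=2$ the equations are $$\frac{d\hat m_2}{dx}=\frac{x^2}8\Bigl(\frac{d(x\tilde\rho_1)}{dx}\Bigr)^2+\frac{x^2\tilde\rho_1^2}{4(1+x^2)}+(1+x^2)\Bigl(\frac{d(x^2\tilde\sigma_2)}{dx}\Bigr)^2+2x^2\tilde\sigma_2^2,\qquad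 \frac{d\hat S_2}{dx}=\frac4{3x}\Bigl(\frac{d(x^2\tilde\sigma_2)}{dx}\Bigr)^2+\frac{x\tilde\rho_1^2}{3(1+x^2)^2}.$$ 2. For every $j\ge2$ the resulting expressions for $d\hat m_j/dx$ and $d\hat S_j/dx$ depend only on the $\hat m_k,\hat S_k$ with $2\le k<j$. 3. There are functions $\hat m_j,\hat S_j:[0,\infty)\to\mathbb R$, $j\ge2$, that solve the system at every order $j\ge2$. They are unique, order by order: for every $J$, any families that solve the system at the orders $2\le j\le J$ agree with them on $[0,\infty)$ at these orders. 4. For every $j\ge2$, the expressions for $d\hat m_j/dx$ and $d\hat S_j/dx$ given by (1), (2) are integrable on $(0,\infty)$, and for all $x\ge 0$, $\hat m_j(x)=\int_0^x\frac{d\hat m_j}{dt}\,dt$ and $\hat S_j(x)=-\int_x^\infty\frac{d\hat S_j}{dt}\,dt$. 5. For every $j\ge2$, $\hat m_j$ and $\hat S_j$ are globally regular, i.e. $C^\infty$ on $[0,\infty)$ (up to and including $x=0$). As $x\to0^+$, $\hat m_j=O(x^3)$, $\hat S_j=\hat S_j(0)+O(x^2)$, $\frac{d\hat m_j}{dx}=O(x^2)$,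 $\frac{d\hat S_j}{dx}=O(x)$. As $x\to\infty$, $\hat m_j=M_j+O(x^{-1})$ for some constant $M_j$, $\hat S_j=O(x^{-4})$, $\frac{d\hat m_j}{dx}=O(x^{-2})$, $\frac{d\hat S_j}{dx}=O(x^{-5})$. -/

import Mathlib

open Set Filter Topology MeasureTheory Asymptotics
open scoped ContDiff

noncomputable section

namespace EYM

/-! ### Special functions -/

/-- The Gauss hypergeometric function `₂F₁(a, b; c; z)` for real parameters `0 < b < c` and real
`z < 1`, through Euler's integral.  On `|z| < 1` this is the sum of the hypergeometric series, and
it is the analytic continuation of that sum to `(-∞, 1)`. -/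
def hyp2F1 (a b c z : ℝ) : ℝ :=
  Real.Gamma c / (Real.Gamma b * Real.Gamma (c - b)) *
    ∫ t in (0 : ℝ)..1, t ^ (b - 1) * (1 - t) ^ (c - b - 1) * (1 - z * t) ^ (-a)

theorem Gamma_add_natCast (b : ℝ) (hb : 0 < b) (n : ℕ) :
    Real.Gamma (b + n) = Real.Gamma b * (ascPochhammer ℝ n).eval b := by
  induction n with
  | zero => simp
  | succ n ih =>
    rw [ascPochhammer_succ_eval]
    push_cast
    rw [← add_assoc, Real.Gamma_add_one (by positivity), ih]; ring

theorem beta_integral (u v : ℝ) (hu : 0 < u) (hv : 0 < v) :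
    IntervalIntegrable (fun t : ℝ => t ^ (u - 1) * (1 - t) ^ (v - 1)) volume 0 1 ∧
    ∫ t in (0 : ℝ)..1, t ^ (u - 1) * (1 - t) ^ (v - 1) =
      Real.Gamma u * Real.Gamma v / Real.Gamma (u + v) := by
  have h1 := Complex.betaIntegral_convergent (u := u) (v := v) (by simpa) (by simpa)
  have h2 := Complex.betaIntegral_eq_Gamma_mul_div u v (by simpa) (by simpa)
  have e : Set.EqOn (fun x : ℝ => (x:ℂ) ^ ((u:ℂ) - 1) * (1 - (x:ℂ)) ^ ((v:ℂ) - 1))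
      (fun t : ℝ => ((t ^ (u - 1) * (1 - t) ^ (v - 1) : ℝ) : ℂ)) (Set.uIcc 0 1) := by
    intro t ht
    rw [Set.uIcc_of_le zero_le_one] at ht
    simp only
    rw [Complex.ofReal_mul, Complex.ofReal_cpow ht.1, Complex.ofReal_cpow (by linarith [ht.2])]
    push_cast
    rfl
  constructor
  · rw [intervalIntegrable_iff] at h1 ⊢
    have h3 := h1.congr_fun (fun x hx => e (Set.uIoc_subset_uIcc hx)) measurableSet_uIoc
    exact h3.re
  · unfold Complex.betaIntegral at h2
    rw [intervalIntegral.integral_congr e, intervalIntegral.integral_ofReal] at h2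
    rw [← Complex.ofReal_add, Complex.Gamma_ofReal, Complex.Gamma_ofReal, Complex.Gamma_ofReal] at h2
    exact_mod_cast h2

theorem binomial_hasSum (a u : ℝ) (hu : |u| < 1) :
    HasSum (fun n : ℕ => ((n.factorial : ℝ)⁻¹ * (ascPochhammer ℝ n).eval a) * u ^ n)
      ((1 - u) ^ (-a)) ∧
    Summable (fun n : ℕ => ‖((n.factorial : ℝ)⁻¹ * (ascPochhammer ℝ n).eval a) * u ^ n‖) := by
  have h := Real.one_add_rpow_hasFPowerSeriesOnBall_zero (a := -a)
  have hm : -u ∈ Metric.eball (0 : ℝ) 1 := by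
    rw [← ENNReal.ofReal_one, Metric.eball_ofReal]; simpa using hu
  have h1 := h.hasSum hm
  have h2 := (binomialSeries ℝ (-a)).summable_norm_apply
    (Metric.eball_subset_eball h.r_le hm)
  have key : ∀ n : ℕ, (binomialSeries ℝ (-a) n fun _ => -u) =
      ((n.factorial : ℝ)⁻¹ * (ascPochhammer ℝ n).eval a) * u ^ n := by
    intro n
    rw [binomialSeries_eq_ordinaryHypergeometricSeries (b := (1 : ℝ))
      (by intro k hk; have : (0 : ℝ) ≤ k := k.cast_nonneg; linarith)]
    have hp : (ascPochhammer ℝ n).eval 1 ≠ 0 := (ascPochhammer_pos n 1 one_pos).ne'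
    rw [FormalMultilinearSeries.compContinuousLinearMap_apply]
    have e : (⇑(-ContinuousLinearMap.id ℝ ℝ) ∘ fun _ : Fin n => -u) = fun _ => u := by
      ext; simp
    rw [e, ordinaryHypergeometricSeries_apply_eq]
    simp only [neg_neg, smul_eq_mul]
    field_simp
  simp only [key] at h1 h2
  refine ⟨?_, h2⟩
  simpa [sub_eq_add_neg] using h1

/-- `hyp2F1` agrees with the sum of the hypergeometric series inside the unit disc. -/
theorem hyp2F1_eq_series (a b c z : ℝ) (hb : 0 < b) (hbc : b < c) (hz : |z| < 1) :
    hyp2F1 a b c z = ordinaryHypergeometric a b c z := by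
  set q : ℕ → ℝ := fun n => (n.factorial : ℝ)⁻¹ * (ascPochhammer ℝ n).eval a with hq
  have hcb : 0 < c - b := by linarith
  set F : ℕ → ℝ → ℝ := fun n t => (q n * z ^ n) * (t ^ (b + n - 1) * (1 - t) ^ (c - b - 1)) with hF
  have hI : ∀ n, IntervalIntegrable (F n) volume 0 1 := fun n =>
    (beta_integral (b + n) (c - b) (by positivity) hcb).1.const_mul _
  have hval : ∀ n, ∫ t in (0 : ℝ)..1, F n t = (q n * z ^ n) *
      (Real.Gamma (b + n) * Real.Gamma (c - b) / Real.Gamma (c + n)) := fun n => by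
    simp only [hF]
    rw [intervalIntegral.integral_const_mul, (beta_integral (b + n) (c - b) (by positivity) hcb).2]
    congr 3; ring
  have hnn : ∀ n : ℕ, ∀ t ∈ Ioc (0 : ℝ) 1, 0 ≤ t ^ (b + n - 1) * (1 - t) ^ (c - b - 1) := by
    intro n t ht
    have := Real.rpow_nonneg ht.1.le (b + n - 1)
    have := Real.rpow_nonneg (sub_nonneg.2 ht.2) (c - b - 1)
    positivity
  have hsum : Summable fun n => ∫ t in Ioc (0 : ℝ) 1, ‖F n t‖ := by
    refine Summable.of_nonneg_of_le (fun n => by positivity) (fun n => ?_)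
      ((binomial_hasSum a z hz).2.mul_right (∫ t in Ioc (0 : ℝ) 1, t ^ (b - 1) * (1 - t) ^ (c - b - 1)))
    rw [← integral_const_mul]
    refine setIntegral_mono_on ?_ ?_ measurableSet_Ioc ?_
    · exact ((intervalIntegrable_iff_integrableOn_Ioc_of_le zero_le_one).1 (hI n)).norm
    · exact ((intervalIntegrable_iff_integrableOn_Ioc_of_le zero_le_one).1
        (beta_integral b (c - b) hb hcb).1).const_mul _
    · intro t ht
      simp only [hF]
      rw [norm_mul, Real.norm_of_nonneg (hnn n t ht)]
      refine mul_le_mul_of_nonneg_left (mul_le_mul_of_nonneg_right ?_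
        (Real.rpow_nonneg (sub_nonneg.2 ht.2) _)) (norm_nonneg _)
      exact Real.rpow_le_rpow_of_exponent_ge ht.1 ht.2 (by simp)
  have hs := hasSum_integral_of_summable_integral_norm
    (fun n => (intervalIntegrable_iff_integrableOn_Ioc_of_le zero_le_one).1 (hI n)) hsum
  have hpt : ∀ t ∈ Ioc (0 : ℝ) 1, ∑' n, F n t =
      t ^ (b - 1) * (1 - t) ^ (c - b - 1) * (1 - z * t) ^ (-a) := by
    intro t ht
    have hzt : |z * t| < 1 := by
      rw [abs_mul, abs_of_pos ht.1]
      nlinarith [ht.1, ht.2, abs_nonneg z]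
    rw [← ((binomial_hasSum a (z * t) hzt).1.mul_left _).tsum_eq]
    refine tsum_congr fun n => ?_
    simp only [hF, hq]
    rw [show b + n - 1 = (b - 1) + n by ring, Real.rpow_add ht.1, Real.rpow_natCast, mul_pow]
    ring
  rw [setIntegral_congr_fun measurableSet_Ioc hpt] at hs
  unfold hyp2F1
  rw [intervalIntegral.integral_of_le zero_le_one, ← hs.tsum_eq, ← tsum_mul_left,
    ordinaryHypergeometric_eq_tsum]
  refine tsum_congr fun n => ?_
  rw [← intervalIntegral.integral_of_le zero_le_one, hval, Gamma_add_natCast b hb, Gamma_add_natCast c (by linarith)]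
  have g1 := (Real.Gamma_pos_of_pos hb).ne'
  have g2 := (Real.Gamma_pos_of_pos hcb).ne'
  have g3 := (Real.Gamma_pos_of_pos (hb.trans hbc)).ne'
  have g4 : (ascPochhammer ℝ n).eval c ≠ 0 := (ascPochhammer_pos n c (hb.trans hbc)).ne'
  simp only [hq, smul_eq_mul]
  field_simp

/-- The Legendre polynomial `P⁰_l`, by Rodrigues' formula. -/
def legendre (l : ℕ) : Polynomial ℝ :=
  Polynomial.C (1 / ((2 : ℝ) ^ l * (l.factorial : ℝ))) *
    Polynomial.derivative^[l] ((Polynomial.X ^ 2 - 1) ^ l)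

/-- `P⁰_l(ξ)`. -/
def P0 (l : ℕ) (ξ : ℝ) : ℝ := (legendre l).eval ξ

/-- The associated Legendre function `P¹_l(ξ) = (1 - ξ²)^{1/2} dP⁰_l/dξ`. -/
def P1 (l : ℕ) (ξ : ℝ) : ℝ :=
  Real.sqrt (1 - ξ ^ 2) * (Polynomial.derivative (legendre l)).eval ξ

/-! ### The gauge sector

`ρ k` (for `k ≥ 1`) and `σ k` (for `k ≥ 2`) are the free constants of the gauge fields. The radial
variable is `x = r / ℓ`, and `ℓ` is the formal expansion parameter. -/

/-- `ρ̃_k(x) = ρ_k ₂F₁(k/2, (k+1)/2; (2k+3)/2; -x²)`. -/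
def rhoT (ρ : ℕ → ℝ) (k : ℕ) (x : ℝ) : ℝ :=
  ρ k * hyp2F1 ((k : ℝ) / 2) (((k : ℝ) + 1) / 2) ((2 * (k : ℝ) + 3) / 2) (-x ^ 2)

/-- `σ̃_k(x) = σ_k ₂F₁(k/2, (k+1)/2; (2k+1)/2; -x²)`. -/
def sigmaT (σ : ℕ → ℝ) (k : ℕ) (x : ℝ) : ℝ :=
  σ k * hyp2F1 ((k : ℝ) / 2) (((k : ℝ) + 1) / 2) ((2 * (k : ℝ) + 1) / 2) (-x ^ 2)

/-- The coefficient of `ℓ^k` in `α = ∑_{k ≥ 1} ρ̃_k(x) P⁰_k(ξ) (xℓ)^k`. -/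
def alphaC (ρ : ℕ → ℝ) (k : ℕ) (x ξ : ℝ) : ℝ :=
  if k = 0 then 0 else rhoT ρ k x * P0 k ξ * x ^ k

/-- The coefficient of `ℓ^k` in `ω = √(1 - ξ²) + ∑_{k ≥ 2} σ̃_k(x) P¹_{k-1}(ξ) (xℓ)^k`. -/
def omegaC (σ : ℕ → ℝ) (k : ℕ) (x ξ : ℝ) : ℝ :=
  if k = 0 then Real.sqrt (1 - ξ ^ 2)
  else if k = 1 then 0
  else sigmaT σ k x * P1 (k - 1) ξ * x ^ k

/-- `∂α/∂r` as a formal power series in `ℓ`. Since `r = ℓ x`, one has `∂/∂r = ℓ⁻¹ ∂/∂x`, and the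
order `ℓ⁰` of `α` is zero, so the coefficients are shifted down by one. -/
def alphaRSeries (ρ : ℕ → ℝ) (x ξ : ℝ) : PowerSeries ℝ :=
  PowerSeries.mk fun k => deriv (fun y => alphaC ρ (k + 1) y ξ) x

/-- `∂ω/∂r` as a formal power series in `ℓ` (the order `ℓ⁰` of `ω` does not depend on `x`). -/
def omegaRSeries (σ : ℕ → ℝ) (x ξ : ℝ) : PowerSeries ℝ :=
  PowerSeries.mk fun k => deriv (fun y => omegaC σ (k + 1) y ξ) x

/-- `∂α/∂ξ` as a formal power series in `ℓ`. -/
def alphaXiSeries (ρ : ℕ → ℝ) (x ξ : ℝ) : PowerSeries ℝ :=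
  PowerSeries.mk fun k => deriv (fun y => alphaC ρ k x y) ξ

/-- `ω` as a formal power series in `ℓ`. -/
def omegaSeries (σ : ℕ → ℝ) (x ξ : ℝ) : PowerSeries ℝ :=
  PowerSeries.mk fun k => omegaC σ k x ξ

/-- `∂/∂ξ (ω² + ξ²)` as a formal power series in `ℓ`. -/
def omegaSqXiSeries (σ : ℕ → ℝ) (x ξ : ℝ) : PowerSeries ℝ :=
  PowerSeries.mk fun k =>
    deriv (fun y => PowerSeries.coeff k (omegaSeries σ x y ^ 2 + PowerSeries.C (y ^ 2))) ξ

/-- `η̂_j`, the coefficient of `ℓ^j` in `η = ½ ∫_{-1}^1 (∂α/∂r)² dξ`. -/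
def etaC (ρ : ℕ → ℝ) (j : ℕ) (x : ℝ) : ℝ :=
  1 / 2 * ∫ ξ in (-1 : ℝ)..1, PowerSeries.coeff j (alphaRSeries ρ x ξ ^ 2)

/-- `ζ̂_j`, the coefficient of `ℓ^j` in `ζ = ½ ∫_{-1}^1 ω² (∂α/∂ξ)² dξ`. -/
def zetaC (ρ σ : ℕ → ℝ) (j : ℕ) (x : ℝ) : ℝ :=
  1 / 2 * ∫ ξ in (-1 : ℝ)..1,
    PowerSeries.coeff j (omegaSeries σ x ξ ^ 2 * alphaXiSeries ρ x ξ ^ 2)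

/-- `Ĝ_j`, the coefficient of `ℓ^j` in `G = ½ ∫_{-1}^1 (∂ω/∂r)² dξ`. -/
def GC (σ : ℕ → ℝ) (j : ℕ) (x : ℝ) : ℝ :=
  1 / 2 * ∫ ξ in (-1 : ℝ)..1, PowerSeries.coeff j (omegaRSeries σ x ξ ^ 2)

/-- `P̂_j`, the coefficient of `ℓ^j` in `P = ⅛ ∫_{-1}^1 (∂/∂ξ (ω² + ξ²))² dξ`. -/
def PC (σ : ℕ → ℝ) (j : ℕ) (x : ℝ) : ℝ :=
  1 / 8 * ∫ ξ in (-1 : ℝ)..1, PowerSeries.coeff j (omegaSqXiSeries σ x ξ ^ 2)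

/-! ### The metric sector -/

/-- `(f ⋆ g)_j = ∑_{k=2}^{j-2} f_k g_{j-k}`, empty for `j < 4`. -/
def conv (f g : ℕ → ℝ → ℝ) (j : ℕ) (x : ℝ) : ℝ :=
  ∑ k ∈ Finset.Icc 2 (j - 2), f k x * g (j - k) x

/-- The coefficient of `ℓ^j`, `j ≥ 2`, in `μ S²`, where `μ = 1 + x² - 2 m̂ / x`,
`m̂ = ∑_{k ≥ 2} m̂_k ℓ^k` and `S = 1 + ∑_{k ≥ 2} Ŝ_k ℓ^k`. -/
def MHat (m S : ℕ → ℝ → ℝ) (j : ℕ) (x : ℝ) : ℝ :=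
  2 * (1 + x ^ 2) * S j x
    - 2 / x * (m j x + 2 * conv m S j x)
    + (1 + x ^ 2) * conv S S j x
    - 2 / x * conv (conv m S) S j x

/-- The coefficient of `ℓ^j`, `j ≥ 2`, in `μ² S`. -/
def MTilde (m S : ℕ → ℝ → ℝ) (j : ℕ) (x : ℝ) : ℝ :=
  (1 + x ^ 2) ^ 2 * S j x
    - 4 * (1 + x ^ 2) / x * (m j x + conv m S j x)
    + 4 / x ^ 2 * (conv m m j x + conv (conv m m) S j x)

/-- The right-hand side of the recursive equation for `dm̂_j/dx`: the order `ℓ^j` of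
`m' = (3/2) (r²η/(4S²) + ζ/(4μS²) + μG + P/r²)`, multiplied through by `μS²` and solved for the
highest order term. -/
def massRHS (ρ σ : ℕ → ℝ) (m S : ℕ → ℝ → ℝ) (j : ℕ) (x : ℝ) : ℝ :=
  3 / 2 *
    (- 2 / (3 * (1 + x ^ 2)) * conv (MHat m S) (fun k => deriv (m k)) j x
      - x / (2 * (1 + x ^ 2)) * conv m (fun k => etaC ρ (k - 2)) j x
      + zetaC ρ σ j x / (4 * (1 + x ^ 2))
      + conv (MHat m S) (GC σ) j x
      - 2 / x * conv m (GC σ) j x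
      - 2 / (x * (1 + x ^ 2)) * conv (conv m (MHat m S)) (GC σ) j x
      + (1 + x ^ 2) * GC σ j x
      + x ^ 2 / 4 * etaC ρ (j - 2) x
      + 1 / x ^ 2 * PC σ (j + 2) x
      + 1 / (x ^ 2 * (1 + x ^ 2)) * conv (MHat m S) (fun k => PC σ (k + 2)) j x)

/-- The right-hand side of the recursive equation for `dŜ_j/dx`: the order `ℓ^j` of
`S'/S = (2/r) (G + ζ/(4μ²S²))`, multiplied through by `μ²S²` and solved for the highest order
term. -/
def lapseRHS (ρ σ : ℕ → ℝ) (m S : ℕ → ℝ → ℝ) (j : ℕ) (x : ℝ) : ℝ :=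
  2 / x * GC σ j x
    + zetaC ρ σ j x / (2 * x * (1 + x ^ 2) ^ 2)
    + 2 / (x * (1 + x ^ 2) ^ 2) * conv (GC σ) (MTilde m S) j x
    + 2 / x * conv (GC σ) S j x
    + 2 / (x * (1 + x ^ 2) ^ 2) * conv (conv (GC σ) S) (MTilde m S) j x
    - 1 / (1 + x ^ 2) ^ 2 * conv (MTilde m S) (fun k => deriv (S k)) j x

/-- `m̂_j` and `Ŝ_j` are continuous on `[0, ∞)`, solve the recursive equations of order `j` on
`(0, ∞)`, and satisfy the boundary conditions `m̂_j(0) = 0` and `Ŝ_j(x) → 0` as `x → ∞`. -/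
structure SolvesOrder (ρ σ : ℕ → ℝ) (m S : ℕ → ℝ → ℝ) (j : ℕ) : Prop where
  mass_cont : ContinuousOn (m j) (Ici 0)
  lapse_cont : ContinuousOn (S j) (Ici 0)
  mass_ode : ∀ x : ℝ, 0 < x → HasDerivAt (m j) (massRHS ρ σ m S j x) x
  lapse_ode : ∀ x : ℝ, 0 < x → HasDerivAt (S j) (lapseRHS ρ σ m S j x) x
  mass_zero : m j 0 = 0
  lapse_infty : Tendsto (S j) atTop (𝓝 0)

end EYM

end

namespace EYM

/-! ### Parametric integrals -/

/-! The proof keeps track of two exponents. `Reg n e f` records the order of vanishing `n` of `f` at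
the origin, with a cofactor smooth across 0, and the growth exponent `e` at infinity. Only `x > 0`
matters, since the right-hand sides divide by `x`. Products add exponents, and a division by `x`
spends one power of `x` at the origin, so smoothness there is never lost.

Gauge sector: Euler's integral shows that the profiles `x^k ₂F₁` are `Reg k 0` and that their
derivatives are `O(x⁻²)` (`reg_hyp2F1`). Each coefficient of `α`, `ω` and their derivatives is a
finite sum of radial times angular factors, up to the endpoints `ξ = ±1` for `∂_ξ(ω² + ξ²)`.
Integration over `ξ` keeps the exponents: `η̂_j`, `Ĝ_j` are `Reg j (-4)`, while `ζ̂_j`, `P̂_j` are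
`Reg j 0`.

Metric sector: the induction hypothesis `LowerReg` assigns `(3, 0)` to `m̂_k`, `(0, -4)` to `Ŝ_k`,
and `(2, -2)`, `(1, -5)` to their derivatives. Inserted into the recursion, these give right-hand
sides of type `(2, -2)` and `(1, -5)` (`reg_massRHS`, `reg_lapseRHS`). The decay is dictated by the
pure gauge terms, as the convolutions decay faster. Both are integrable, and integrating from 0,
respectively from infinity, reproduces the hypothesis at the next order (`mass_spec`, `lapse_spec`).

The recursion is well founded because both indices of a convolution of order `j` lie in `[2, j-2]`
(`rhs_congr`). The same locality gives uniqueness, by strong induction and the fundamental theorem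
of calculus. -/

theorem hasDerivAt_integral_comp_mul {w v φ : ℝ → ℝ} (hw : Continuous w) (hv : Continuous v)
    (hφ : ContDiff ℝ 1 φ) (x : ℝ) :
    HasDerivAt (fun x => ∫ t in (0 : ℝ)..1, w t * φ (x * v t))
      (∫ t in (0 : ℝ)..1, (w t * v t) * deriv φ (x * v t)) x := by
  have hφc : Continuous φ := hφ.continuous
  have hφ' : Continuous (deriv φ) := hφ.continuous_deriv le_rfl
  -- Continuity on a compact box around `x` supplies a constant dominating function.
  have hK : IsCompact (Icc (x - 1) (x + 1) ×ˢ Icc (0 : ℝ) 1) := isCompact_Icc.prod isCompact_Icc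
  obtain ⟨C, hC⟩ := hK.exists_bound_of_continuousOn
    (f := fun p : ℝ × ℝ => (w p.2 * v p.2) * deriv φ (p.1 * v p.2)) (by fun_prop)
  refine (intervalIntegral.hasDerivAt_integral_of_dominated_loc_of_deriv_le
    (F := fun x t => w t * φ (x * v t)) (F' := fun x t => (w t * v t) * deriv φ (x * v t))
    (s := Icc (x - 1) (x + 1)) (bound := fun _ => C)
    (Icc_mem_nhds (by linarith) (by linarith)) ?_ ?_ ?_ ?_ ?_ ?_).2
  · exact Eventually.of_forall fun y => Continuous.aestronglyMeasurable (by fun_prop)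
  · exact Continuous.intervalIntegrable (by fun_prop) _ _
  · exact Continuous.aestronglyMeasurable (by fun_prop)
  · refine Eventually.of_forall fun t ht y hy => hC (y, t) ⟨hy, ?_⟩
    rw [uIoc_of_le zero_le_one] at ht
    exact ⟨ht.1.le, ht.2⟩
  · exact intervalIntegrable_const
  · refine Eventually.of_forall fun t _ y _ => ?_
    have h := ((hφ.differentiable one_ne_zero (y * v t)).hasDerivAt.comp y
      ((hasDerivAt_id y).mul_const (v t))).const_mul (w t)
    refine h.congr_deriv ?_
    ring

/-- Differentiation under the integral reproduces the same form, with `w * v` in place of `w` and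
`φ'` in place of `φ`, so the induction runs over all `w` and `φ`. -/
theorem contDiff_integral_comp_mul {w v φ : ℝ → ℝ} (hw : Continuous w) (hv : Continuous v)
    (hφ : ContDiff ℝ ∞ φ) : ContDiff ℝ ∞ fun x => ∫ t in (0 : ℝ)..1, w t * φ (x * v t) := by
  refine contDiff_infty.2 fun n => ?_
  induction n generalizing w φ with
  | zero =>
    refine contDiff_zero.2 (continuous_iff_continuousAt.2 fun x => ?_)
    exact (hasDerivAt_integral_comp_mul hw hv (hφ.of_le (by exact_mod_cast le_top)) x).continuousAt
  | succ n ih =>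
    have hd := hasDerivAt_integral_comp_mul hw hv (hφ.of_le (by exact_mod_cast le_top))
    push_cast
    rw [contDiff_succ_iff_deriv]
    refine ⟨fun x => (hd x).differentiableAt, by simp, ?_⟩
    rw [show deriv (fun x => ∫ t in (0 : ℝ)..1, w t * φ (x * v t)) = _ from
      funext fun x => (hd x).deriv]
    exact ih (hw.mul hv) (contDiff_infty_iff_deriv.1 hφ).2

/-- The primitive of `xⁿ s(x)` vanishes to order `n + 1` at the origin. -/
theorem exists_contDiff_integral_pow_mul (n : ℕ) {s : ℝ → ℝ} (hs : ContDiff ℝ ∞ s) :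
    ∃ u : ℝ → ℝ, ContDiff ℝ ∞ u ∧ ∀ x, ∫ t in (0 : ℝ)..x, t ^ n * s t = x ^ (n + 1) * u x := by
  -- The substitution `t ↦ x t` pulls out `x ^ (n + 1)` and leaves this integral.
  refine ⟨fun x => ∫ t in (0 : ℝ)..1, t ^ n * s (x * t),
    contDiff_integral_comp_mul (by fun_prop) continuous_id hs, fun x => ?_⟩
  have h := intervalIntegral.mul_integral_comp_mul_left (a := 0) (b := 1)
    (f := fun t => t ^ n * s t) (c := x)
  simp only [mul_zero, mul_one] at h
  rw [← h, pow_succ', mul_assoc, ← intervalIntegral.integral_const_mul (x ^ n)]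
  congr 1
  refine intervalIntegral.integral_congr fun t _ => ?_
  simp only [mul_pow]
  ring

/-! ### Functions with prescribed orders at the origin and at infinity -/

/-- On `(0, ∞)` the function `f` is `xⁿ` times a smooth function on the line, and `f = O(x^e)` at
infinity. -/
def Reg (n : ℕ) (e : ℤ) (f : ℝ → ℝ) : Prop :=
  (∃ s : ℝ → ℝ, ContDiff ℝ ∞ s ∧ ∀ x, 0 < x → f x = x ^ n * s x) ∧
    f =O[atTop] fun x : ℝ => x ^ e

theorem zpow_isBigO_zpow {e e' : ℤ} (h : e ≤ e') :
    (fun x : ℝ => x ^ e) =O[atTop] fun x : ℝ => x ^ e' := by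
  refine IsBigO.of_bound 1 ?_
  filter_upwards [eventually_ge_atTop 1] with x hx
  rw [one_mul, Real.norm_of_nonneg (by positivity), Real.norm_of_nonneg (by positivity)]
  exact zpow_le_zpow_right₀ hx h

namespace Reg

variable {n n' : ℕ} {e e' : ℤ} {f g : ℝ → ℝ}

theorem mono (h : Reg n e f) (hn : n' ≤ n) (he : e ≤ e') : Reg n' e' f := by
  obtain ⟨⟨s, hs, hfs⟩, hO⟩ := h
  refine ⟨⟨fun x => x ^ (n - n') * s x, by fun_prop, fun x hx => ?_⟩,
    hO.trans (zpow_isBigO_zpow he)⟩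
  rw [hfs x hx, ← mul_assoc, ← pow_add, Nat.add_sub_cancel' hn]

theorem congr (h : Reg n e f) (hfg : ∀ x, 0 < x → g x = f x) : Reg n e g := by
  obtain ⟨⟨s, hs, hfs⟩, hO⟩ := h
  refine ⟨⟨s, hs, fun x hx => (hfg x hx).trans (hfs x hx)⟩, hO.congr' ?_ EventuallyEq.rfl⟩
  filter_upwards [eventually_gt_atTop 0] with x hx
  exact (hfg x hx).symm

theorem zero : Reg n e fun _ => 0 :=
  ⟨⟨fun _ => 0, contDiff_const, by simp⟩, isBigO_zero _ _⟩

theorem add (hf : Reg n e f) (hg : Reg n e g) : Reg n e fun x => f x + g x := by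
  obtain ⟨⟨s, hs, hfs⟩, hO⟩ := hf
  obtain ⟨⟨s', hs', hfs'⟩, hO'⟩ := hg
  refine ⟨⟨fun x => s x + s' x, hs.add hs', fun x hx => ?_⟩, hO.add hO'⟩
  simp only [hfs x hx, hfs' x hx, mul_add]

theorem const_mul (c : ℝ) (hf : Reg n e f) : Reg n e fun x => c * f x := by
  obtain ⟨⟨s, hs, hfs⟩, hO⟩ := hf
  refine ⟨⟨fun x => c * s x, contDiff_const.mul hs, fun x hx => ?_⟩, hO.const_mul_left c⟩
  simp only [hfs x hx]; ring

theorem neg (hf : Reg n e f) : Reg n e fun x => -f x :=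
  (hf.const_mul (-1)).congr fun x _ => by ring

theorem sub (hf : Reg n e f) (hg : Reg n e g) : Reg n e fun x => f x - g x :=
  (hf.add hg.neg).congr fun x _ => by ring

theorem mul (hf : Reg n e f) (hg : Reg n' e' g) :
    Reg (n + n') (e + e') fun x => f x * g x := by
  obtain ⟨⟨s, hs, hfs⟩, hO⟩ := hf
  obtain ⟨⟨s', hs', hfs'⟩, hO'⟩ := hg
  refine ⟨⟨fun x => s x * s' x, hs.mul hs', fun x hx => ?_⟩, (hO.mul hO').congr' EventuallyEq.rfl ?_⟩
  · simp only [hfs x hx, hfs' x hx]; ring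
  · filter_upwards [eventually_gt_atTop 0] with x hx
    rw [zpow_add₀ hx.ne']

theorem sum {ι : Type*} {F : ι → ℝ → ℝ} (I : Finset ι) (h : ∀ i ∈ I, Reg n e (F i)) :
    Reg n e fun x => ∑ i ∈ I, F i x := by
  classical
  induction I using Finset.induction_on with
  | empty => simpa using Reg.zero
  | insert i I hi ih =>
    simp only [Finset.sum_insert hi]
    exact (h i (by simp)).add (ih fun k hk => h k (by simp [hk]))

theorem pow_id (n : ℕ) : Reg n n fun x => x ^ n :=
  ⟨⟨fun _ => 1, contDiff_const, by simp⟩, by simpa using isBigO_refl _ _⟩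

theorem const (c : ℝ) : Reg 0 0 fun _ => c :=
  ((pow_id 0).const_mul c).congr fun x _ => by simp

theorem id : Reg 1 1 fun x => x := (pow_id 1).congr fun x _ => by simp

theorem div_id (hf : Reg (n + 1) e f) : Reg n (e - 1) fun x => f x / x := by
  obtain ⟨⟨s, hs, hfs⟩, hO⟩ := hf
  refine ⟨⟨s, hs, fun x hx => ?_⟩, ?_⟩
  · simp only [hfs x hx]; rw [div_eq_iff hx.ne']; ring
  · refine (hO.mul (isBigO_refl (fun x : ℝ => x⁻¹) atTop)).congr' ?_ ?_
    · exact Eventually.of_forall fun x => (div_eq_mul_inv _ _).symm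
    · filter_upwards [eventually_gt_atTop 0] with x hx
      rw [zpow_sub_one₀ hx.ne']

theorem one_add_sq : Reg 0 2 fun x => 1 + x ^ 2 :=
  ((const 1).mono le_rfl (by norm_num)).add ((pow_id 2).mono (Nat.zero_le _) (by norm_num))

theorem div_one_add_sq (hf : Reg n e f) : Reg n (e - 2) fun x => f x / (1 + x ^ 2) := by
  have h : Reg 0 (-2) fun x => (1 + x ^ 2)⁻¹ := by
    refine ⟨⟨fun x => (1 + x ^ 2)⁻¹, ?_, by simp⟩, ?_⟩
    · exact ContDiff.inv (by fun_prop) fun x => by positivity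
    · refine IsBigO.of_bound 1 ?_
      filter_upwards [eventually_gt_atTop 0] with x hx
      rw [one_mul, Real.norm_of_nonneg (by positivity), Real.norm_of_nonneg (by positivity),
        zpow_neg]
      refine inv_anti₀ (by positivity) ?_
      norm_cast
      linarith
  exact (hf.mul h).congr fun x _ => div_eq_mul_inv _ _

end Reg

/-! ### The hypergeometric profiles -/

theorem contDiff_one_add_sq_rpow (p : ℝ) : ContDiff ℝ ∞ fun y : ℝ => (1 + y ^ 2) ^ p :=
  ContDiff.rpow_const_of_ne (by fun_prop) fun y => by positivity

theorem hasDerivAt_one_add_sq_rpow (p y : ℝ) :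
    HasDerivAt (fun y : ℝ => (1 + y ^ 2) ^ p) (2 * p * y * (1 + y ^ 2) ^ (p - 1)) y := by
  have h : HasDerivAt (fun y : ℝ => 1 + y ^ 2) (2 * y) y := by
    simpa using (hasDerivAt_pow 2 y).const_add 1
  refine (h.rpow_const (Or.inl (by positivity))).congr_deriv ?_
  ring

/-- Euler's integral with `t` replaced by `√t ^ 2`, which is smooth in the parameter. -/
noncomputable def eulerInt (w : ℝ → ℝ) (p x : ℝ) : ℝ :=
  ∫ t in (0 : ℝ)..1, w t * (1 + (x * √t) ^ 2) ^ p

theorem contDiff_eulerInt {w : ℝ → ℝ} (hw : Continuous w) (p : ℝ) :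
    ContDiff ℝ ∞ (eulerInt w p) :=
  contDiff_integral_comp_mul hw Real.continuous_sqrt (contDiff_one_add_sq_rpow p)

theorem continuous_eulerInt_integrand {w : ℝ → ℝ} (hw : Continuous w) (p x : ℝ) :
    Continuous fun t : ℝ => w t * (1 + (x * √t) ^ 2) ^ p :=
  hw.mul ((contDiff_one_add_sq_rpow p).continuous.comp
    (continuous_const.mul Real.continuous_sqrt))

/-- With `φ_p(y) = (1 + y²)^p` one has `y φ_p' = 2p (φ_p - φ_{p-1})`. Since `2p = -(k+1)`, the `φ_p`
term cancels against the derivative of `x^{k+1}`. The surviving integral has a lower exponent, and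
this is the source of the decay of the derivative. -/
theorem hasDerivAt_eulerInt_mul_pow {w : ℝ → ℝ} (hw : Continuous w) (k : ℕ) {x : ℝ} :
    HasDerivAt (fun x => eulerInt w (-((k + 1 : ℕ) / 2 : ℝ)) x * x ^ (k + 1))
      ((k + 1) * x ^ k * eulerInt w (-((k + 1 : ℕ) / 2 : ℝ) - 1) x) x := by
  set p : ℝ := -((k + 1 : ℕ) / 2 : ℝ) with hp
  have h := hasDerivAt_integral_comp_mul hw Real.continuous_sqrt
    ((contDiff_one_add_sq_rpow p).of_le (by exact_mod_cast le_top)) x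
  refine (h.mul (hasDerivAt_pow (k + 1) x)).congr_deriv ?_
  have e1 : (∫ t in (0 : ℝ)..1, w t * √t * deriv (fun y : ℝ => (1 + y ^ 2) ^ p) (x * √t)) * x =
      2 * p * (eulerInt w p x - eulerInt w (p - 1) x) := by
    unfold eulerInt
    rw [← intervalIntegral.integral_sub
      ((continuous_eulerInt_integrand hw _ _).intervalIntegrable _ _)
      ((continuous_eulerInt_integrand hw _ _).intervalIntegrable _ _),
      ← intervalIntegral.integral_const_mul, ← intervalIntegral.integral_mul_const]
    refine intervalIntegral.integral_congr fun t _ => ?_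
    have hpos : 0 < 1 + (x * √t) ^ 2 := by positivity
    have e3 : (1 + (x * √t) ^ 2) ^ p = (1 + (x * √t) ^ 2) * (1 + (x * √t) ^ 2) ^ (p - 1) := by
      rw [Real.rpow_sub_one hpos.ne', mul_div_cancel₀ _ hpos.ne']
    rw [(hasDerivAt_one_add_sq_rpow p _).deriv, e3]
    ring
  have e2 : 2 * p = -(k + 1) := by rw [hp]; push_cast; ring
  rw [e2] at e1
  change _ * x ^ (k + 1) + eulerInt w p x * _ = _
  rw [pow_succ', ← mul_assoc, e1]
  push_cast
  ring

theorem integral_one_add_mul_rpow {x q : ℝ} (hx : 0 < x) (hq : q ≠ 1) :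
    ∫ t in (0 : ℝ)..1, (1 + x ^ 2 * t) ^ (-q) =
      ((1 + x ^ 2) ^ (1 - q) - 1) / (x ^ 2 * (1 - q)) := by
  have hq' : 1 - q ≠ 0 := sub_ne_zero.2 hq.symm
  have hpos : ∀ t ∈ uIcc (0 : ℝ) 1, 0 < 1 + x ^ 2 * t := fun t ht => by
    rw [uIcc_of_le zero_le_one] at ht
    have := ht.1
    positivity
  rw [intervalIntegral.integral_eq_sub_of_hasDerivAt
    (f := fun t => (1 + x ^ 2 * t) ^ (1 - q) / (x ^ 2 * (1 - q)))]
  · simp [sub_div]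
  · intro t ht
    have h : HasDerivAt (fun t : ℝ => 1 + x ^ 2 * t) (x ^ 2) t := by
      simpa using ((hasDerivAt_id t).const_mul (x ^ 2)).const_add 1
    refine ((h.rpow_const (Or.inl (hpos t ht).ne')).div_const _).congr_deriv ?_
    rw [show 1 - q - 1 = -q by ring]
    field_simp
  · refine ContinuousOn.intervalIntegrable fun t ht => ContinuousAt.continuousWithinAt ?_
    exact ContinuousAt.rpow_const (by fun_prop) (Or.inl (hpos t ht).ne')

/-- The bound on `w` gives `x^k |w| ≤ (x² t)^{k/2} ≤ (1 + x² t)^{k/2}`, which absorbs the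
`k`-dependent part of the exponent. What remains is elementary; it is used with `q = 1/2` for the
profile and `q = 3/2` for its derivative. -/
theorem abs_pow_mul_eulerInt_le {w : ℝ → ℝ} (k : ℕ)
    (hb : ∀ t ∈ Icc (0 : ℝ) 1, |w t| ≤ t ^ (k / 2 : ℝ)) {x q : ℝ} (hx : 0 < x) :
    |x ^ k * eulerInt w (-(k / 2 : ℝ) - q) x| ≤ ∫ t in (0 : ℝ)..1, (1 + x ^ 2 * t) ^ (-q) := by
  unfold eulerInt
  rw [← intervalIntegral.integral_const_mul, ← Real.norm_eq_abs]
  refine intervalIntegral.norm_integral_le_of_norm_le zero_le_one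
    (Eventually.of_forall fun t ht => ?_) ?_
  · have ht0 := ht.1.le
    have hpos : 0 < 1 + x ^ 2 * t := by positivity
    rw [mul_pow, Real.sq_sqrt ht0, Real.norm_eq_abs, abs_mul, abs_mul, abs_of_pos (pow_pos hx k),
      abs_of_pos (Real.rpow_pos_of_pos hpos _), ← mul_assoc]
    have h1 : x ^ k * |w t| ≤ (1 + x ^ 2 * t) ^ (k / 2 : ℝ) := by
      calc x ^ k * |w t| ≤ x ^ k * t ^ (k / 2 : ℝ) := by
            gcongr; exact hb t ⟨ht0, ht.2⟩
        _ = (x ^ 2 * t) ^ (k / 2 : ℝ) := by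
            rw [Real.mul_rpow (by positivity) ht0, ← Real.rpow_natCast x 2, ← Real.rpow_mul hx.le,
              ← Real.rpow_natCast x k]
            congr 2
            push_cast; ring
        _ ≤ _ := by
            refine Real.rpow_le_rpow (by positivity) (by linarith) (by positivity)
    calc x ^ k * |w t| * (1 + x ^ 2 * t) ^ (-(k / 2 : ℝ) - q)
        ≤ (1 + x ^ 2 * t) ^ (k / 2 : ℝ) * (1 + x ^ 2 * t) ^ (-(k / 2 : ℝ) - q) := by gcongr
      _ = _ := by rw [← Real.rpow_add hpos]; congr 1; ring
  · refine ContinuousOn.intervalIntegrable fun t ht => ContinuousAt.continuousWithinAt ?_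
    rw [uIcc_of_le zero_le_one] at ht
    have := ht.1
    exact ContinuousAt.rpow_const (by fun_prop) (Or.inl (by positivity))

theorem abs_eulerInt_mul_pow_le {w : ℝ → ℝ} (k : ℕ)
    (hb : ∀ t ∈ Icc (0 : ℝ) 1, |w t| ≤ t ^ (k / 2 : ℝ)) {x : ℝ} (hx : 0 < x) :
    |eulerInt w (-((k + 1 : ℕ) / 2 : ℝ)) x * x ^ (k + 1)| ≤ 2 := by
  have h := abs_pow_mul_eulerInt_le k hb (q := 1 / 2) hx
  rw [integral_one_add_mul_rpow hx (by norm_num)] at h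
  rw [show -((k + 1 : ℕ) / 2 : ℝ) = -(k / 2 : ℝ) - 1 / 2 by push_cast; ring,
    show ∀ a : ℝ, a * x ^ (k + 1) = x * (x ^ k * a) by intro a; ring, abs_mul, abs_of_pos hx]
  refine (mul_le_mul_of_nonneg_left h hx.le).trans ?_
  -- The integral equals `2 (√(1 + x²) - 1) / x²`, hence is at most `2 / x`.
  have h2 : (1 + x ^ 2) ^ (1 - 1 / 2 : ℝ) ≤ 1 + x := by
    rw [show (1 - 1 / 2 : ℝ) = 1 / 2 by norm_num, ← Real.sqrt_eq_rpow]
    exact Real.sqrt_le_iff.2 ⟨by positivity, by nlinarith⟩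
  rw [← mul_div_assoc, div_le_iff₀ (by positivity)]
  nlinarith

theorem abs_deriv_eulerInt_mul_pow_le {w : ℝ → ℝ} (hw : Continuous w) (k : ℕ)
    (hb : ∀ t ∈ Icc (0 : ℝ) 1, |w t| ≤ t ^ (k / 2 : ℝ)) {x : ℝ} (hx : 0 < x) :
    |deriv (fun x => eulerInt w (-((k + 1 : ℕ) / 2 : ℝ)) x * x ^ (k + 1)) x| ≤
      2 * (k + 1) / x ^ 2 := by
  have h := abs_pow_mul_eulerInt_le k hb (q := 3 / 2) hx
  rw [integral_one_add_mul_rpow hx (by norm_num)] at h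
  rw [(hasDerivAt_eulerInt_mul_pow hw k).deriv,
    show -((k + 1 : ℕ) / 2 : ℝ) - 1 = -(k / 2 : ℝ) - 3 / 2 by push_cast; ring, mul_assoc, abs_mul,
    abs_of_pos (by positivity)]
  refine (mul_le_mul_of_nonneg_left h (by positivity)).trans ?_
  have h2 : 0 ≤ (1 + x ^ 2) ^ (1 - 3 / 2 : ℝ) := by positivity
  rw [mul_comm 2, mul_div_assoc]
  refine mul_le_mul_of_nonneg_left ?_ (by positivity)
  rw [show x ^ 2 * (1 - 3 / 2 : ℝ) = -(x ^ 2 / 2) by ring, div_neg, neg_le,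
    ← neg_div, div_le_div_iff₀ (by positivity) (by positivity)]
  nlinarith [sq_nonneg x, mul_nonneg h2 (sq_nonneg x)]

theorem contDiff_eulerInt_mul_pow {w : ℝ → ℝ} (hw : Continuous w) (p : ℝ) (k : ℕ) :
    ContDiff ℝ ∞ fun x => eulerInt w p x * x ^ k :=
  (contDiff_eulerInt hw p).mul (by fun_prop)

theorem reg_eulerInt_mul_pow {w : ℝ → ℝ} (hw : Continuous w) (k : ℕ)
    (hb : ∀ t ∈ Icc (0 : ℝ) 1, |w t| ≤ t ^ (k / 2 : ℝ)) :
    Reg (k + 1) 0 fun x => eulerInt w (-((k + 1 : ℕ) / 2 : ℝ)) x * x ^ (k + 1) := by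
  refine ⟨⟨_, contDiff_eulerInt hw _, fun x _ => mul_comm _ _⟩, IsBigO.of_bound 2 ?_⟩
  filter_upwards [eventually_gt_atTop 0] with x hx
  simpa using abs_eulerInt_mul_pow_le k hb hx

theorem reg_deriv_eulerInt_mul_pow {w : ℝ → ℝ} (hw : Continuous w) (k : ℕ)
    (hb : ∀ t ∈ Icc (0 : ℝ) 1, |w t| ≤ t ^ (k / 2 : ℝ)) :
    Reg k (-2) (deriv fun x => eulerInt w (-((k + 1 : ℕ) / 2 : ℝ)) x * x ^ (k + 1)) := by
  refine ⟨⟨fun x => (k + 1) * eulerInt w (-((k + 1 : ℕ) / 2 : ℝ) - 1) x,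
    contDiff_const.mul (contDiff_eulerInt hw _), fun x _ => ?_⟩,
    IsBigO.of_bound (2 * (k + 1)) ?_⟩
  · rw [(hasDerivAt_eulerInt_mul_pow hw k).deriv]; ring
  · filter_upwards [eventually_gt_atTop 0] with x hx
    have h := abs_deriv_eulerInt_mul_pow_le hw k hb hx
    rw [Real.norm_eq_abs, Real.norm_of_nonneg (by positivity), zpow_neg, ← div_eq_mul_inv]
    exact_mod_cast h

theorem hyp2F1_eq_eulerInt (a b c x : ℝ) :
    hyp2F1 a b c (-x ^ 2) = Real.Gamma c / (Real.Gamma b * Real.Gamma (c - b)) *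
      eulerInt (fun t => t ^ (b - 1) * (1 - t) ^ (c - b - 1)) (-a) x := by
  unfold hyp2F1 eulerInt
  congr 1
  refine intervalIntegral.integral_congr fun t ht => ?_
  rw [uIcc_of_le zero_le_one] at ht
  simp only [mul_pow, Real.sq_sqrt ht.1, neg_mul, sub_neg_eq_add]

/-- `x^{k+1} ₂F₁((k+1)/2, (k+2)/2; c; -x²)` for `c ≥ (k+4)/2`: behaviour at both ends. -/
theorem reg_hyp2F1 (k : ℕ) {c : ℝ} (hc : ((k : ℝ) + 4) / 2 ≤ c) :
    (ContDiff ℝ ∞ fun x : ℝ =>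
      hyp2F1 (((k + 1 : ℕ) : ℝ) / 2) ((((k + 1 : ℕ) : ℝ) + 1) / 2) c (-x ^ 2) * x ^ (k + 1)) ∧
    (Reg (k + 1) 0 fun x : ℝ =>
      hyp2F1 (((k + 1 : ℕ) : ℝ) / 2) ((((k + 1 : ℕ) : ℝ) + 1) / 2) c (-x ^ 2) * x ^ (k + 1)) ∧
    Reg k (-2) (deriv fun x : ℝ =>
      hyp2F1 (((k + 1 : ℕ) : ℝ) / 2) ((((k + 1 : ℕ) : ℝ) + 1) / 2) c (-x ^ 2) * x ^ (k + 1)) := by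
  simp only [hyp2F1_eq_eulerInt, mul_assoc]
  set C := Real.Gamma c / (Real.Gamma ((((k + 1 : ℕ) : ℝ) + 1) / 2) *
    Real.Gamma (c - (((k + 1 : ℕ) : ℝ) + 1) / 2))
  set w : ℝ → ℝ := fun t => t ^ ((((k + 1 : ℕ) : ℝ) + 1) / 2 - 1) *
    (1 - t) ^ (c - (((k + 1 : ℕ) : ℝ) + 1) / 2 - 1) with hwdef
  -- Both exponents of Euler's weight are nonnegative: the first is `k/2`, and the second is
  -- controlled by `hc`. So `w` is continuous on the line and at most `t^{k/2}` on `[0, 1]`.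
  have e1 : 0 ≤ (((k + 1 : ℕ) : ℝ) + 1) / 2 - 1 := by
    push_cast; linarith [(Nat.cast_nonneg k : (0 : ℝ) ≤ k)]
  have e2 : 0 ≤ c - (((k + 1 : ℕ) : ℝ) + 1) / 2 - 1 := by push_cast; linarith
  have hw : Continuous w :=
    (Real.continuous_rpow_const e1).mul ((continuous_const.sub continuous_id).rpow_const
      fun _ => Or.inr e2)
  have hb : ∀ t ∈ Icc (0 : ℝ) 1, |w t| ≤ t ^ (k / 2 : ℝ) := by
    intro t ht
    have h1 := Real.rpow_nonneg ht.1 ((((k + 1 : ℕ) : ℝ) + 1) / 2 - 1)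
    have h2 := Real.rpow_nonneg (sub_nonneg.2 ht.2) (c - (((k + 1 : ℕ) : ℝ) + 1) / 2 - 1)
    have h3 := Real.rpow_le_one (sub_nonneg.2 ht.2) (by linarith [ht.1]) e2
    simp only [hwdef]
    rw [abs_of_nonneg (mul_nonneg h1 h2)]
    refine (mul_le_of_le_one_right h1 h3).trans_eq ?_
    congr 1; push_cast; ring
  have hd : Differentiable ℝ fun x => eulerInt w (-((k + 1 : ℕ) / 2 : ℝ)) x * x ^ (k + 1) :=
    fun x => (hasDerivAt_eulerInt_mul_pow hw k).differentiableAt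
  refine ⟨contDiff_const.mul (contDiff_eulerInt_mul_pow hw _ _),
    (reg_eulerInt_mul_pow hw k hb).const_mul C, ?_⟩
  refine ((reg_deriv_eulerInt_mul_pow hw k hb).const_mul C).congr fun x _ => ?_
  exact deriv_const_mul C (hd x)

/-- The radial profile `ρ̃_k(x) x^k` (zero for `k = 0`). -/
noncomputable def rhoProf (ρ : ℕ → ℝ) (k : ℕ) (x : ℝ) : ℝ := if k = 0 then 0 else rhoT ρ k x * x ^ k

/-- The radial profile of `ω`: `1` for `k = 0`, zero for `k = 1`, and `σ̃_k(x) x^k` for `k ≥ 2`. -/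
noncomputable def sigmaProf (σ : ℕ → ℝ) (k : ℕ) (x : ℝ) : ℝ :=
  if k = 0 then 1 else if k = 1 then 0 else sigmaT σ k x * x ^ k

theorem rhoProf_reg_succ (ρ : ℕ → ℝ) (k : ℕ) :
    ContDiff ℝ ∞ (rhoProf ρ (k + 1)) ∧ Reg (k + 1) 0 (rhoProf ρ (k + 1)) ∧
      Reg k (-2) (deriv (rhoProf ρ (k + 1))) := by
  have h := reg_hyp2F1 k (c := (2 * ((k + 1 : ℕ) : ℝ) + 3) / 2) (by
    push_cast; linarith [(Nat.cast_nonneg k : (0 : ℝ) ≤ k)])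
  have e : rhoProf ρ (k + 1) = fun x => ρ (k + 1) *
      (hyp2F1 (((k + 1 : ℕ) : ℝ) / 2) ((((k + 1 : ℕ) : ℝ) + 1) / 2)
        ((2 * ((k + 1 : ℕ) : ℝ) + 3) / 2) (-x ^ 2) * x ^ (k + 1)) := by
    ext x
    simp [rhoProf, rhoT, mul_assoc]
  rw [e]
  refine ⟨contDiff_const.mul h.1, h.2.1.const_mul _, (h.2.2.const_mul (ρ (k + 1))).congr ?_⟩
  exact fun x _ => deriv_const_mul _ (h.1.differentiable (by simp) x)

theorem sigmaProf_reg_succ (σ : ℕ → ℝ) (k : ℕ) :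
    ContDiff ℝ ∞ (sigmaProf σ (k + 1)) ∧ Reg (k + 1) 0 (sigmaProf σ (k + 1)) ∧
      Reg k (-2) (deriv (sigmaProf σ (k + 1))) := by
  rcases Nat.eq_zero_or_pos k with rfl | hk
  -- This case is separate because `c = 3/2` would violate the condition `c ≥ 2` of `reg_hyp2F1`.
  · have e : sigmaProf σ (0 + 1) = fun _ => 0 := by ext x; simp [sigmaProf]
    rw [e]
    exact ⟨contDiff_const, Reg.zero, Reg.zero.congr fun x _ => by simp⟩
  have h := reg_hyp2F1 k (c := (2 * ((k + 1 : ℕ) : ℝ) + 1) / 2) (by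
    have : (1 : ℝ) ≤ k := by exact_mod_cast hk
    push_cast; linarith)
  have e : sigmaProf σ (k + 1) = fun x => σ (k + 1) *
      (hyp2F1 (((k + 1 : ℕ) : ℝ) / 2) ((((k + 1 : ℕ) : ℝ) + 1) / 2)
        ((2 * ((k + 1 : ℕ) : ℝ) + 1) / 2) (-x ^ 2) * x ^ (k + 1)) := by
    ext x
    simp [sigmaProf, sigmaT, hk.ne', mul_assoc]
  rw [e]
  refine ⟨contDiff_const.mul h.1, h.2.1.const_mul _, (h.2.2.const_mul (σ (k + 1))).congr ?_⟩
  exact fun x _ => deriv_const_mul _ (h.1.differentiable (by simp) x)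

theorem reg_rhoProf (ρ : ℕ → ℝ) (k : ℕ) : Reg k 0 (rhoProf ρ k) := by
  cases k with
  | zero => exact Reg.zero.congr fun x _ => by simp [rhoProf]
  | succ k => exact (rhoProf_reg_succ ρ k).2.1

theorem reg_sigmaProf (σ : ℕ → ℝ) (k : ℕ) : Reg k 0 (sigmaProf σ k) := by
  cases k with
  | zero => exact (Reg.const 1).congr fun x _ => by simp [sigmaProf]
  | succ k => exact (sigmaProf_reg_succ σ k).2.1

/-! ### Separable functions and the angular integrals -/

/-- Finite sums of products `f(x) q(ξ)` with `f` of prescribed orders and `q` continuous. -/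
def Sep (n : ℕ) (e : ℤ) : Submodule ℝ (ℝ → ℝ → ℝ) :=
  Submodule.span ℝ {F | ∃ f q : ℝ → ℝ, Reg n e f ∧ Continuous q ∧ F = fun x ξ => f x * q ξ}

theorem mul_mem_Sep {n : ℕ} {e : ℤ} {f q : ℝ → ℝ} (hf : Reg n e f) (hq : Continuous q) :
    (fun x ξ => f x * q ξ) ∈ Sep n e :=
  Submodule.subset_span ⟨f, q, hf, hq, rfl⟩

theorem Sep.mul_mem {n n' : ℕ} {e e' : ℤ} {F G : ℝ → ℝ → ℝ} (hF : F ∈ Sep n e)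
    (hG : G ∈ Sep n' e') : (fun x ξ => F x ξ * G x ξ) ∈ Sep (n + n') (e + e') := by
  have h : F * G ∈ Sep n e * Sep n' e' := Submodule.mul_mem_mul hF hG
  unfold Sep at h
  rw [Submodule.span_mul_span] at h
  refine Submodule.span_mono ?_ h
  rintro _ ⟨_, ⟨f, q, hf, hq, rfl⟩, _, ⟨f', q', hf', hq', rfl⟩, rfl⟩
  refine ⟨_, _, hf.mul hf', hq.mul hq', ?_⟩
  ext x ξ
  change f x * q ξ * (f' x * q' ξ) = f x * f' x * (q ξ * q' ξ)
  ring

theorem Sep.sum_mem {n : ℕ} {e : ℤ} {ι : Type*} (I : Finset ι) {F : ι → ℝ → ℝ → ℝ}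
    (h : ∀ i ∈ I, F i ∈ Sep n e) : (fun x ξ => ∑ i ∈ I, F i x ξ) ∈ Sep n e := by
  have := Submodule.sum_mem (Sep n e) h
  convert this using 1
  ext x ξ
  simp [Finset.sum_apply]

/-- Continuity in `ξ` is carried through the induction because additivity of the integral needs
integrable summands. -/
theorem Sep.continuous_and_reg {n : ℕ} {e : ℤ} {F : ℝ → ℝ → ℝ} (hF : F ∈ Sep n e) :
    (∀ x, Continuous (F x)) ∧ Reg n e fun x => ∫ ξ in (-1 : ℝ)..1, F x ξ := by
  induction hF using Submodule.span_induction with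
  | mem F h =>
    obtain ⟨f, q, hf, hq, rfl⟩ := h
    refine ⟨fun x => by fun_prop, (hf.const_mul (∫ ξ in (-1 : ℝ)..1, q ξ)).congr fun x _ => ?_⟩
    rw [intervalIntegral.integral_const_mul, mul_comm]
  | zero => exact ⟨fun x => continuous_const, Reg.zero.congr fun x _ => by simp⟩
  | add F G _ _ hF hG =>
    refine ⟨fun x => (hF.1 x).add (hG.1 x), (hF.2.add hG.2).congr fun x _ => ?_⟩
    exact intervalIntegral.integral_add ((hF.1 x).intervalIntegrable _ _)
      ((hG.1 x).intervalIntegrable _ _)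
  | smul c F _ hF =>
    refine ⟨fun x => (hF.1 x).const_smul c, (hF.2.const_mul c).congr fun x _ => ?_⟩
    exact intervalIntegral.integral_smul c _

/-- The coefficient of `ℓ^k` is separable, of order `k` at the origin and `e` at infinity. -/
def SepSeries (e : ℤ) (A : ℝ → ℝ → PowerSeries ℝ) : Prop :=
  ∀ k, (fun x ξ => PowerSeries.coeff k (A x ξ)) ∈ Sep k e

/-- Tying the order at the origin to the power of `ℓ` makes it additive over the antidiagonal of the
Cauchy product. -/
theorem SepSeries.mul {e e' : ℤ} {A B : ℝ → ℝ → PowerSeries ℝ} (hA : SepSeries e A)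
    (hB : SepSeries e' B) : SepSeries (e + e') fun x ξ => A x ξ * B x ξ := by
  intro k
  simp only [PowerSeries.coeff_mul]
  refine Sep.sum_mem _ fun p hp => ?_
  rw [← Finset.HasAntidiagonal.mem_antidiagonal.1 hp]
  exact Sep.mul_mem (hA p.1) (hB p.2)

theorem SepSeries.sq {e : ℤ} {A : ℝ → ℝ → PowerSeries ℝ} (hA : SepSeries e A) :
    SepSeries (e + e) fun x ξ => A x ξ ^ 2 := by
  simpa only [pow_two] using hA.mul hA

/-! ### The coefficients of the gauge fields -/

theorem continuous_P0 (k : ℕ) : Continuous (P0 k) := (legendre k).continuous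

theorem alphaC_eq (ρ : ℕ → ℝ) (k : ℕ) (x ξ : ℝ) : alphaC ρ k x ξ = rhoProf ρ k x * P0 k ξ := by
  unfold alphaC rhoProf
  split_ifs <;> ring

/-- `ω = √(1 - ξ²) ∑_k sigmaProf_k(x) q_k(ξ) ℓ^k` with these polynomials `q_k`. -/
noncomputable def omegaPoly (k : ℕ) : Polynomial ℝ :=
  if k = 0 then 1 else Polynomial.derivative (legendre (k - 1))

theorem omegaC_eq (σ : ℕ → ℝ) (k : ℕ) (x ξ : ℝ) :
    omegaC σ k x ξ = sigmaProf σ k x * (√(1 - ξ ^ 2) * (omegaPoly k).eval ξ) := by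
  unfold omegaC sigmaProf omegaPoly P1
  split_ifs
  · simp
  · simp
  · ring

theorem continuous_sqrt_mul_omegaPoly (k : ℕ) :
    Continuous fun ξ : ℝ => √(1 - ξ ^ 2) * (omegaPoly k).eval ξ :=
  (Real.continuous_sqrt.comp (by fun_prop)).mul (omegaPoly k).continuous

/-- `∂/∂r` lowers the power of `ℓ` and the order in `x` together, so the two still match. -/
theorem sepSeries_alphaR (ρ : ℕ → ℝ) : SepSeries (-2) (alphaRSeries ρ) := by
  intro k
  simp only [alphaRSeries, PowerSeries.coeff_mk, alphaC_eq, deriv_mul_const_field]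
  exact mul_mem_Sep (rhoProf_reg_succ ρ k).2.2 (continuous_P0 _)

theorem sepSeries_omegaR (σ : ℕ → ℝ) : SepSeries (-2) (omegaRSeries σ) := by
  intro k
  simp only [omegaRSeries, PowerSeries.coeff_mk, omegaC_eq, deriv_mul_const_field]
  exact mul_mem_Sep (sigmaProf_reg_succ σ k).2.2 (continuous_sqrt_mul_omegaPoly _)

theorem sepSeries_alphaXi (ρ : ℕ → ℝ) : SepSeries 0 (alphaXiSeries ρ) := by
  intro k
  simp only [alphaXiSeries, PowerSeries.coeff_mk, alphaC_eq, deriv_const_mul_field']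
  have h : deriv (P0 k) = fun ξ => (Polynomial.derivative (legendre k)).eval ξ :=
    funext fun ξ => (legendre k).deriv
  refine mul_mem_Sep (q := deriv (P0 k)) (reg_rhoProf ρ k) ?_
  rw [h]
  exact (Polynomial.derivative (legendre k)).continuous

theorem sepSeries_omega (σ : ℕ → ℝ) : SepSeries 0 (omegaSeries σ) := by
  intro k
  simp only [omegaSeries, PowerSeries.coeff_mk, omegaC_eq]
  exact mul_mem_Sep (reg_sigmaProf σ k) (continuous_sqrt_mul_omegaPoly _)

/-- `∂/∂ξ (ω² + ξ²)` in the interval `(-1, 1)`, where `ω²` is a polynomial in `ξ`. -/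
noncomputable def omegaSqXiPoly (σ : ℕ → ℝ) (x ξ : ℝ) : PowerSeries ℝ :=
  PowerSeries.mk fun k => if k = 0 then 0 else
    ∑ p ∈ Finset.HasAntidiagonal.antidiagonal k, sigmaProf σ p.1 x * sigmaProf σ p.2 x *
      (Polynomial.derivative ((1 - Polynomial.X ^ 2) * (omegaPoly p.1 * omegaPoly p.2))).eval ξ

theorem sepSeries_omegaSqXiPoly (σ : ℕ → ℝ) : SepSeries 0 (omegaSqXiPoly σ) := by
  intro k
  simp only [omegaSqXiPoly, PowerSeries.coeff_mk]
  split_ifs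
  · exact Submodule.zero_mem _
  · refine Sep.sum_mem _ fun p hp => ?_
    rw [← Finset.HasAntidiagonal.mem_antidiagonal.1 hp]
    exact mul_mem_Sep ((reg_sigmaProf σ p.1).mul (reg_sigmaProf σ p.2)) (Polynomial.continuous _)

theorem coeff_omegaSeries_sq {σ : ℕ → ℝ} (k : ℕ) (x : ℝ) {ξ : ℝ} (hξ : ξ ∈ Icc (-1 : ℝ) 1) :
    PowerSeries.coeff k (omegaSeries σ x ξ ^ 2) =
      ∑ p ∈ Finset.HasAntidiagonal.antidiagonal k, sigmaProf σ p.1 x * sigmaProf σ p.2 x *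
        ((1 - Polynomial.X ^ 2) * (omegaPoly p.1 * omegaPoly p.2)).eval ξ := by
  rw [sq, PowerSeries.coeff_mul]
  refine Finset.sum_congr rfl fun p _ => ?_
  simp only [omegaSeries, PowerSeries.coeff_mk, omegaC_eq, Polynomial.eval_mul,
    Polynomial.eval_sub, Polynomial.eval_one, Polynomial.eval_pow, Polynomial.eval_X]
  have h := Real.sq_sqrt (show 0 ≤ 1 - ξ ^ 2 by nlinarith [hξ.1, hξ.2])
  linear_combination sigmaProf σ p.1 x * sigmaProf σ p.2 x * (omegaPoly p.1).eval ξ *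
    (omegaPoly p.2).eval ξ * h

/-- The endpoints are excluded because beyond them `√(1 - ξ²)` is truncated to 0 and `ω²` is no
longer the polynomial; they do not affect the integral in `PC_eq`. At order 0 the term `ξ²`
completes `ω²` to the constant 1. -/
theorem omegaSqXiSeries_eq (σ : ℕ → ℝ) (x : ℝ) {ξ : ℝ} (hξ : ξ ∈ Ioo (-1 : ℝ) 1) :
    omegaSqXiSeries σ x ξ = omegaSqXiPoly σ x ξ := by
  ext k
  simp only [omegaSqXiSeries, omegaSqXiPoly, PowerSeries.coeff_mk]
  have hn : ∀ᶠ y in 𝓝 ξ, y ∈ Icc (-1 : ℝ) 1 := by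
    filter_upwards [Ioo_mem_nhds hξ.1 hξ.2] with y hy using Ioo_subset_Icc_self hy
  split_ifs with hk
  · subst hk
    have h : (fun y => PowerSeries.coeff 0 (omegaSeries σ x y ^ 2 + PowerSeries.C (y ^ 2)))
        =ᶠ[𝓝 ξ] fun _ => 1 := by
      filter_upwards [hn] with y hy
      rw [map_add, coeff_omegaSeries_sq 0 x hy]
      simp [sigmaProf, omegaPoly]
    rw [h.deriv_eq, deriv_const]
  · have h : (fun y => PowerSeries.coeff k (omegaSeries σ x y ^ 2 + PowerSeries.C (y ^ 2)))
        =ᶠ[𝓝 ξ] fun y => ∑ p ∈ Finset.HasAntidiagonal.antidiagonal k, sigmaProf σ p.1 x * sigmaProf σ p.2 x *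
          ((1 - Polynomial.X ^ 2) * (omegaPoly p.1 * omegaPoly p.2)).eval y := by
      filter_upwards [hn] with y hy
      rw [map_add, coeff_omegaSeries_sq k x hy, PowerSeries.coeff_C, if_neg hk, add_zero]
    rw [h.deriv_eq]
    refine HasDerivAt.deriv (HasDerivAt.fun_sum fun p _ => ?_)
    exact (Polynomial.hasDerivAt _ _).const_mul _

theorem PC_eq (σ : ℕ → ℝ) (j : ℕ) (x : ℝ) :
    PC σ j x = 1 / 8 * ∫ ξ in (-1 : ℝ)..1, PowerSeries.coeff j (omegaSqXiPoly σ x ξ ^ 2) := by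
  unfold PC
  congr 1
  refine intervalIntegral.integral_congr_Ioo_of_le (by norm_num) fun ξ hξ => ?_
  simp only [omegaSqXiSeries_eq σ x hξ]

theorem reg_etaC (ρ : ℕ → ℝ) (j : ℕ) : Reg j (-4) (etaC ρ j) :=
  (Sep.continuous_and_reg ((sepSeries_alphaR ρ).sq j)).2.const_mul _

theorem reg_zetaC (ρ σ : ℕ → ℝ) (j : ℕ) : Reg j 0 (zetaC ρ σ j) :=
  (Sep.continuous_and_reg (((sepSeries_omega σ).sq.mul (sepSeries_alphaXi ρ).sq) j)).2.const_mul _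

theorem reg_GC (σ : ℕ → ℝ) (j : ℕ) : Reg j (-4) (GC σ j) :=
  (Sep.continuous_and_reg ((sepSeries_omegaR σ).sq j)).2.const_mul _

theorem reg_PC (σ : ℕ → ℝ) (j : ℕ) : Reg j 0 (PC σ j) :=
  ((Sep.continuous_and_reg ((sepSeries_omegaSqXiPoly σ).sq j)).2.const_mul (1 / 8)).congr
    fun x _ => PC_eq σ j x

/-! ### The lowest order -/

theorem legendre_one : legendre 1 = Polynomial.X := by
  simp only [legendre, Function.iterate_one, pow_one, Nat.factorial_one, Nat.cast_one, mul_one,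
    Polynomial.derivative_sub, Polynomial.derivative_X_sq, Polynomial.derivative_one, sub_zero]
  rw [← mul_assoc, ← Polynomial.C_mul]
  norm_num

theorem integral_sq_neg_one_one : ∫ ξ in (-1 : ℝ)..1, ξ ^ 2 = 2 / 3 := by
  rw [integral_pow]; norm_num

theorem integral_one_sub_sq_neg_one_one : ∫ ξ in (-1 : ℝ)..1, (1 - ξ ^ 2) = 4 / 3 := by
  rw [intervalIntegral.integral_sub (by simp) (Continuous.intervalIntegrable (by fun_prop) _ _),
    integral_sq_neg_one_one]
  norm_num

theorem etaC_zero (ρ : ℕ → ℝ) (x : ℝ) :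
    etaC ρ 0 x = 1 / 3 * deriv (fun y => y * rhoT ρ 1 y) x ^ 2 := by
  have h : ∀ ξ : ℝ, PowerSeries.coeff 0 (alphaRSeries ρ x ξ ^ 2) =
      deriv (fun y => y * rhoT ρ 1 y) x ^ 2 * ξ ^ 2 := by
    intro ξ
    have e : (fun y => alphaC ρ (0 + 1) y ξ) = fun y => y * rhoT ρ 1 y * ξ := by
      ext y; simp [alphaC, P0, legendre_one]; ring
    rw [PowerSeries.coeff_zero_eq_constantCoeff_apply, map_pow,
      ← PowerSeries.coeff_zero_eq_constantCoeff_apply, alphaRSeries, PowerSeries.coeff_mk, e,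
      deriv_mul_const_field, mul_pow]
  simp only [etaC, h]
  rw [intervalIntegral.integral_const_mul, integral_sq_neg_one_one]
  ring

theorem zetaC_two (ρ σ : ℕ → ℝ) (x : ℝ) :
    zetaC ρ σ 2 x = 2 / 3 * (x ^ 2 * rhoT ρ 1 x ^ 2) := by
  have h : ∀ ξ ∈ uIcc (-1 : ℝ) 1,
      PowerSeries.coeff 2 (omegaSeries σ x ξ ^ 2 * alphaXiSeries ρ x ξ ^ 2) =
        x ^ 2 * rhoT ρ 1 x ^ 2 * (1 - ξ ^ 2) := by
    intro ξ hξ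
    rw [uIcc_of_le (by norm_num)] at hξ
    have a0 : PowerSeries.coeff 0 (alphaXiSeries ρ x ξ) = 0 := by
      simp [alphaXiSeries, alphaC]
    have a1 : PowerSeries.coeff 1 (alphaXiSeries ρ x ξ) = rhoT ρ 1 x * x := by
      have e : (fun y => alphaC ρ 1 x y) = fun y => rhoT ρ 1 x * x * y := by
        ext y; simp [alphaC, P0, legendre_one]; ring
      rw [alphaXiSeries, PowerSeries.coeff_mk, e]
      simp
    have w0 : PowerSeries.coeff 0 (omegaSeries σ x ξ ^ 2) = 1 - ξ ^ 2 := by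
      rw [coeff_omegaSeries_sq 0 x hξ]
      simp [sigmaProf, omegaPoly]
    have s0 : PowerSeries.coeff 0 (alphaXiSeries ρ x ξ ^ 2) = 0 := by
      rw [sq, PowerSeries.coeff_mul]; simp [a0, -PowerSeries.coeff_zero_eq_constantCoeff]
    have s1 : PowerSeries.coeff 1 (alphaXiSeries ρ x ξ ^ 2) = 0 := by
      rw [sq, PowerSeries.coeff_mul]
      simp [Finset.Nat.antidiagonal_succ, a0,
        -PowerSeries.coeff_zero_eq_constantCoeff]
    have s2 : PowerSeries.coeff 2 (alphaXiSeries ρ x ξ ^ 2) = (rhoT ρ 1 x * x) ^ 2 := by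
      rw [sq, PowerSeries.coeff_mul]
      simp [Finset.Nat.antidiagonal_succ, a0, a1, -PowerSeries.coeff_zero_eq_constantCoeff]
      ring
    rw [PowerSeries.coeff_mul]
    simp [Finset.Nat.antidiagonal_succ, s0, s1, s2, w0, -PowerSeries.coeff_zero_eq_constantCoeff]
    ring
  rw [zetaC, intervalIntegral.integral_congr h, intervalIntegral.integral_const_mul,
    integral_one_sub_sq_neg_one_one]
  ring

theorem GC_two (σ : ℕ → ℝ) (x : ℝ) :
    GC σ 2 x = 2 / 3 * deriv (fun y => y ^ 2 * sigmaT σ 2 y) x ^ 2 := by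
  have h : ∀ ξ ∈ uIcc (-1 : ℝ) 1, PowerSeries.coeff 2 (omegaRSeries σ x ξ ^ 2) =
      deriv (fun y => y ^ 2 * sigmaT σ 2 y) x ^ 2 * (1 - ξ ^ 2) := by
    intro ξ hξ
    rw [uIcc_of_le (by norm_num)] at hξ
    have c0 : PowerSeries.coeff 0 (omegaRSeries σ x ξ) = 0 := by
      simp [omegaRSeries, omegaC]
    have c1 : PowerSeries.coeff 1 (omegaRSeries σ x ξ) =
        deriv (fun y => y ^ 2 * sigmaT σ 2 y) x * √(1 - ξ ^ 2) := by
      have e : (fun y => omegaC σ (1 + 1) y ξ) =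
          fun y => y ^ 2 * sigmaT σ 2 y * √(1 - ξ ^ 2) := by
        ext y; simp [omegaC, P1, legendre_one]; ring
      rw [omegaRSeries, PowerSeries.coeff_mk, e, deriv_mul_const_field]
    rw [sq, PowerSeries.coeff_mul]
    simp [Finset.Nat.antidiagonal_succ, c0, c1, -PowerSeries.coeff_zero_eq_constantCoeff]
    rw [← sq, mul_pow, Real.sq_sqrt (by nlinarith [hξ.1, hξ.2])]
  rw [GC, intervalIntegral.integral_congr h, intervalIntegral.integral_const_mul,
    integral_one_sub_sq_neg_one_one]
  ring

theorem PC_four (σ : ℕ → ℝ) (x : ℝ) : PC σ 4 x = 4 / 3 * (x ^ 4 * sigmaT σ 2 x ^ 2) := by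
  have h : ∀ ξ : ℝ, PowerSeries.coeff 4 (omegaSqXiPoly σ x ξ ^ 2) =
      16 * (x ^ 4 * sigmaT σ 2 x ^ 2) * ξ ^ 2 := by
    intro ξ
    have b0 : PowerSeries.coeff 0 (omegaSqXiPoly σ x ξ) = 0 := by
      simp [omegaSqXiPoly]
    have b1 : PowerSeries.coeff 1 (omegaSqXiPoly σ x ξ) = 0 := by
      simp [omegaSqXiPoly, Finset.Nat.antidiagonal_succ, sigmaProf]
    -- The `ℓ²` coefficient of `ω²` is `2 x² σ̃₂ (1 - ξ²)`. Orders 0 and 1 vanish, so only the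
    -- square of its `ξ`-derivative reaches `ℓ⁴`.
    have b2 : PowerSeries.coeff 2 (omegaSqXiPoly σ x ξ) = -4 * (x ^ 2 * sigmaT σ 2 x) * ξ := by
      simp [omegaSqXiPoly, Finset.Nat.antidiagonal_succ, sigmaProf, omegaPoly, legendre_one]
      ring
    rw [sq, PowerSeries.coeff_mul]
    simp [Finset.Nat.antidiagonal_succ, b0, b1, b2, -PowerSeries.coeff_zero_eq_constantCoeff]
    ring
  rw [PC_eq]
  simp only [h]
  rw [intervalIntegral.integral_const_mul, integral_sq_neg_one_one]
  ring

theorem conv_two (f g : ℕ → ℝ → ℝ) (x : ℝ) : conv f g 2 x = 0 := by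
  simp [conv]

theorem massRHS_two (ρ σ : ℕ → ℝ) (m S : ℕ → ℝ → ℝ) {x : ℝ} (hx : 0 < x) :
    massRHS ρ σ m S 2 x =
      x ^ 2 / 8 * (deriv (fun y => y * rhoT ρ 1 y) x) ^ 2
        + x ^ 2 * rhoT ρ 1 x ^ 2 / (4 * (1 + x ^ 2))
        + (1 + x ^ 2) * (deriv (fun y => y ^ 2 * sigmaT σ 2 y) x) ^ 2
        + 2 * x ^ 2 * sigmaT σ 2 x ^ 2 := by
  simp only [massRHS, conv_two, Nat.sub_self, Nat.reduceAdd, etaC_zero, zetaC_two, GC_two, PC_four]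
  field_simp
  ring

theorem lapseRHS_two (ρ σ : ℕ → ℝ) (m S : ℕ → ℝ → ℝ) {x : ℝ} (hx : 0 < x) :
    lapseRHS ρ σ m S 2 x =
      4 / (3 * x) * (deriv (fun y => y ^ 2 * sigmaT σ 2 y) x) ^ 2
        + x * rhoT ρ 1 x ^ 2 / (3 * (1 + x ^ 2) ^ 2) := by
  simp only [lapseRHS, conv_two, zetaC_two, GC_two]
  field_simp
  ring

/-! ### Locality of the recursive equations -/

/-- The right-hand sides contain derivatives of lower-order functions; on the open half-line
agreement passes to germs. -/
theorem eqOn_deriv_Ioi {f g : ℝ → ℝ} (h : EqOn f g (Ioi 0)) :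
    EqOn (deriv f) (deriv g) (Ioi 0) := fun _ hx =>
  (h.eventuallyEq_of_mem (Ioi_mem_nhds hx)).deriv_eq

/-- In a convolution of order `j` both `k` and `j - k` lie in `[2, j-2]`, hence strictly below `J`.
-/
theorem conv_congr {f g f' g' : ℕ → ℝ → ℝ} {J j : ℕ} {x : ℝ}
    (hf : ∀ k, 2 ≤ k → k < J → f k x = f' k x) (hg : ∀ k, 2 ≤ k → k < J → g k x = g' k x)
    (hj : j ≤ J) : conv f g j x = conv f' g' j x := by
  refine Finset.sum_congr rfl fun k hk => ?_
  rw [Finset.mem_Icc] at hk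
  rw [hf k (by omega) (by omega), hg (j - k) (by omega) (by omega)]

theorem MHat_congr {m S m' S' : ℕ → ℝ → ℝ} {J : ℕ} {x : ℝ}
    (hm : ∀ k, 2 ≤ k → k < J → m k x = m' k x) (hS : ∀ k, 2 ≤ k → k < J → S k x = S' k x)
    {k : ℕ} (hk : 2 ≤ k) (hkJ : k < J) : MHat m S k x = MHat m' S' k x := by
  unfold MHat
  rw [hm k hk hkJ, hS k hk hkJ, conv_congr hm hS hkJ.le, conv_congr hS hS hkJ.le,
    conv_congr (fun i _ hi => conv_congr hm hS hi.le) hS hkJ.le]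

theorem MTilde_congr {m S m' S' : ℕ → ℝ → ℝ} {J : ℕ} {x : ℝ}
    (hm : ∀ k, 2 ≤ k → k < J → m k x = m' k x) (hS : ∀ k, 2 ≤ k → k < J → S k x = S' k x)
    {k : ℕ} (hk : 2 ≤ k) (hkJ : k < J) : MTilde m S k x = MTilde m' S' k x := by
  unfold MTilde
  rw [hm k hk hkJ, hS k hk hkJ, conv_congr hm hS hkJ.le, conv_congr hm hm hkJ.le,
    conv_congr (fun i _ hi => conv_congr hm hm hi.le) hS hkJ.le]

/-- The right-hand sides of order `j` involve only the metric functions of lower order. -/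
theorem rhs_congr (ρ σ : ℕ → ℝ) {m S m' S' : ℕ → ℝ → ℝ} {j : ℕ}
    (h : ∀ k, 2 ≤ k → k < j → EqOn (m k) (m' k) (Ioi 0) ∧ EqOn (S k) (S' k) (Ioi 0)) :
    EqOn (massRHS ρ σ m S j) (massRHS ρ σ m' S' j) (Ioi 0) ∧
      EqOn (lapseRHS ρ σ m S j) (lapseRHS ρ σ m' S' j) (Ioi 0) := by
  have hd : ∀ x ∈ Ioi (0 : ℝ), (∀ k, 2 ≤ k → k < j → m k x = m' k x) ∧
      (∀ k, 2 ≤ k → k < j → S k x = S' k x) ∧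
      (∀ k, 2 ≤ k → k < j → deriv (m k) x = deriv (m' k) x) ∧
      (∀ k, 2 ≤ k → k < j → deriv (S k) x = deriv (S' k) x) := fun x hx =>
    ⟨fun k hk hkj => (h k hk hkj).1 hx, fun k hk hkj => (h k hk hkj).2 hx,
      fun k hk hkj => eqOn_deriv_Ioi (h k hk hkj).1 hx,
      fun k hk hkj => eqOn_deriv_Ioi (h k hk hkj).2 hx⟩
  constructor
  · intro x hx
    obtain ⟨hm, hS, hm', hS'⟩ := hd x hx
    unfold massRHS
    rw [conv_congr (fun i hi hij => MHat_congr hm hS hi hij) hm' le_rfl,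
      conv_congr hm (fun _ _ _ => rfl) le_rfl,
      conv_congr (g := GC σ) (fun i hi hij => MHat_congr hm hS hi hij) (fun _ _ _ => rfl) le_rfl,
      conv_congr (g := GC σ) hm (fun _ _ _ => rfl) le_rfl,
      conv_congr (f := conv m (MHat m S)) (g := GC σ)
        (fun i _ hij => conv_congr hm (fun i hi hij => MHat_congr hm hS hi hij) hij.le)
        (fun _ _ _ => rfl) le_rfl,
      conv_congr (g := fun k => PC σ (k + 2)) (fun i hi hij => MHat_congr hm hS hi hij)
        (fun _ _ _ => rfl) le_rfl]
  · intro x hx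
    obtain ⟨hm, hS, hm', hS'⟩ := hd x hx
    unfold lapseRHS
    rw [conv_congr (f := GC σ) (fun _ _ _ => rfl) (fun i hi hij => MTilde_congr hm hS hi hij)
        le_rfl,
      conv_congr (f := GC σ) (fun _ _ _ => rfl) hS le_rfl,
      conv_congr (f := conv (GC σ) S) (fun i _ hij => conv_congr (fun _ _ _ => rfl) hS hij.le)
        (fun i hi hij => MTilde_congr hm hS hi hij) le_rfl,
      conv_congr (fun i hi hij => MTilde_congr hm hS hi hij) hS' le_rfl]

/-! ### Regularity of the right-hand sides -/

/-- The orders at the origin and at infinity of the metric functions below order `J`. -/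
structure LowerReg (m S : ℕ → ℝ → ℝ) (J : ℕ) : Prop where
  mass : ∀ k, 2 ≤ k → k < J → Reg 3 0 (m k)
  lapse : ∀ k, 2 ≤ k → k < J → Reg 0 (-4) (S k)
  deriv_mass : ∀ k, 2 ≤ k → k < J → Reg 2 (-2) (deriv (m k))
  deriv_lapse : ∀ k, 2 ≤ k → k < J → Reg 1 (-5) (deriv (S k))

theorem reg_conv {n n' : ℕ} {e e' : ℤ} {f g : ℕ → ℝ → ℝ} {J j : ℕ}
    (hf : ∀ k, 2 ≤ k → k < J → Reg n e (f k)) (hg : ∀ k, 2 ≤ k → k < J → Reg n' e' (g k))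
    (hj : j ≤ J) : Reg (n + n') (e + e') (conv f g j) := by
  refine Reg.sum _ fun k hk => ?_
  rw [Finset.mem_Icc] at hk
  exact (hf k (by omega) (by omega)).mul (hg (j - k) (by omega) (by omega))

section

variable {m S : ℕ → ℝ → ℝ} {J : ℕ}

/-- The exponent `-1` comes from `m̂_k / x`. Nothing better than order 0 at the origin is available,
as `Ŝ_k(0)` need not vanish. -/
theorem LowerReg.reg_MHat (h : LowerReg m S J) {k : ℕ} (hk : 2 ≤ k) (hkJ : k < J) :
    Reg 0 (-1) (MHat m S k) := by
  have t1 : Reg 0 (-1) fun x => 2 * (1 + x ^ 2) * S k x :=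
    (((Reg.one_add_sq.mul (h.lapse k hk hkJ)).mono le_rfl (by norm_num)).const_mul 2).congr
      fun x _ => by ring
  have t2 : Reg 0 (-1) fun x => 2 / x * (m k x + 2 * conv m S k x) := by
    have a : Reg 1 0 (conv m S k) :=
      (reg_conv h.mass h.lapse hkJ.le).mono (by norm_num) (by norm_num)
    have b := ((h.mass k hk hkJ).mono (n' := 1) (by norm_num) le_rfl).add (a.const_mul 2)
    exact (b.div_id.const_mul 2).congr fun x _ => by ring
  have t3 : Reg 0 (-1) fun x => (1 + x ^ 2) * conv S S k x :=
    (Reg.one_add_sq.mul (reg_conv h.lapse h.lapse hkJ.le)).mono le_rfl (by norm_num)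
  have t4 : Reg 0 (-1) fun x => 2 / x * conv (conv m S) S k x := by
    have a : Reg 1 0 (conv (conv m S) S k) :=
      (reg_conv (fun i _ hi => reg_conv h.mass h.lapse hi.le) h.lapse hkJ.le).mono
        (by norm_num) (by norm_num)
    exact (a.div_id.const_mul 2).congr fun x _ => by ring
  exact ((t1.sub t2).add t3).sub t4

/-- The exponent `1` comes from `(1 + x²) m̂_k / x`. -/
theorem LowerReg.reg_MTilde (h : LowerReg m S J) {k : ℕ} (hk : 2 ≤ k) (hkJ : k < J) :
    Reg 0 1 (MTilde m S k) := by
  have t1 : Reg 0 1 fun x => (1 + x ^ 2) ^ 2 * S k x :=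
    ((Reg.one_add_sq.mul (Reg.one_add_sq.mul (h.lapse k hk hkJ))).mono le_rfl
      (by norm_num)).congr fun x _ => by ring
  have t2 : Reg 0 1 fun x => 4 * (1 + x ^ 2) / x * (m k x + conv m S k x) := by
    have a : Reg 1 0 (conv m S k) :=
      (reg_conv h.mass h.lapse hkJ.le).mono (by norm_num) (by norm_num)
    have b := ((h.mass k hk hkJ).mono (n' := 1) (by norm_num) le_rfl).add a
    exact ((Reg.one_add_sq.mul b.div_id).const_mul 4).congr fun x _ => by ring
  have t3 : Reg 0 1 fun x => 4 / x ^ 2 * (conv m m k x + conv (conv m m) S k x) := by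
    have a : Reg 2 3 (conv m m k) :=
      (reg_conv h.mass h.mass hkJ.le).mono (by norm_num) (by norm_num)
    have b : Reg 2 3 (conv (conv m m) S k) :=
      (reg_conv (fun i _ hi => reg_conv h.mass h.mass hi.le) h.lapse hkJ.le).mono
        (by norm_num) (by norm_num)
    exact ((a.add b).div_id.div_id.const_mul 4).congr fun x _ => by ring
  exact (t1.sub t2).add t3

/-- The exponent `-2` is set by the gauge terms `t3`, `t7`, `t8`, `t9`; the exponents of all
convolution terms add up to `-5` or less. -/
theorem LowerReg.reg_massRHS (h : LowerReg m S J) (hJ : 2 ≤ J) (ρ σ : ℕ → ℝ) :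
    Reg 2 (-2) (massRHS ρ σ m S J) := by
  have hG : ∀ k, 2 ≤ k → k < J → Reg 2 (-4) (GC σ k) :=
    fun k hk _ => (reg_GC σ k).mono hk le_rfl
  have hM : ∀ k, 2 ≤ k → k < J → Reg 0 (-1) (MHat m S k) := fun k hk hkJ => h.reg_MHat hk hkJ
  have t1 : Reg 2 (-2) fun x =>
      -2 / (3 * (1 + x ^ 2)) * conv (MHat m S) (fun k => deriv (m k)) J x :=
    (((reg_conv hM h.deriv_mass le_rfl).div_one_add_sq.mono le_rfl (by norm_num)).const_mul
      (-2 / 3)).congr fun x _ => by field_simp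
  have t2 : Reg 2 (-2) fun x =>
      x / (2 * (1 + x ^ 2)) * conv m (fun k => etaC ρ (k - 2)) J x :=
    (((Reg.id.mul (reg_conv h.mass (g := fun k => etaC ρ (k - 2)) (fun k _ _ =>
      (reg_etaC ρ (k - 2)).mono (Nat.zero_le _) le_rfl) le_rfl)).div_one_add_sq.mono
        (by norm_num) (by norm_num)).const_mul (1 / 2)).congr fun x _ => by field_simp
  have t3 : Reg 2 (-2) fun x => zetaC ρ σ J x / (4 * (1 + x ^ 2)) :=
    (((reg_zetaC ρ σ J).div_one_add_sq.mono hJ (by norm_num)).const_mul (1 / 4)).congr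
      fun x _ => by field_simp
  have t4 : Reg 2 (-2) fun x => conv (MHat m S) (GC σ) J x :=
    (reg_conv hM hG le_rfl).mono (by norm_num) (by norm_num)
  have t5 : Reg 2 (-2) fun x => 2 / x * conv m (GC σ) J x :=
    ((((reg_conv h.mass hG le_rfl).mono (n' := 3) (e' := -1) (by norm_num)
      (by norm_num)).div_id.mono le_rfl (by norm_num)).const_mul 2).congr fun x _ => by ring
  have t6 : Reg 2 (-2) fun x =>
      2 / (x * (1 + x ^ 2)) * conv (conv m (MHat m S)) (GC σ) J x :=
    (((((reg_conv (fun i _ hi => reg_conv h.mass hM hi.le) hG le_rfl).mono (n' := 3) (e' := 0)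
      (by norm_num) (by norm_num)).div_id.div_one_add_sq).mono le_rfl (by norm_num)).const_mul
        2).congr fun x _ => by field_simp
  have t7 : Reg 2 (-2) fun x => (1 + x ^ 2) * GC σ J x :=
    (Reg.one_add_sq.mul (reg_GC σ J)).mono (by omega) (by norm_num)
  have t8 : Reg 2 (-2) fun x => x ^ 2 / 4 * etaC ρ (J - 2) x :=
    ((((Reg.pow_id 2).mul (reg_etaC ρ (J - 2))).mono (by omega) (by norm_num)).const_mul
      (1 / 4)).congr fun x _ => by ring
  -- The shift to `J + 2 ≥ 4` pays for the two divisions by `x`.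
  have t9 : Reg 2 (-2) fun x => 1 / x ^ 2 * PC σ (J + 2) x :=
    ((((reg_PC σ (J + 2)).mono (n' := 4) (by omega) le_rfl).div_id.div_id).mono le_rfl
      (by norm_num)).congr fun x _ => by ring
  have t10 : Reg 2 (-2) fun x =>
      1 / (x ^ 2 * (1 + x ^ 2)) * conv (MHat m S) (fun k => PC σ (k + 2)) J x :=
    ((((reg_conv hM (g := fun k => PC σ (k + 2)) (fun k hk _ =>
      (reg_PC σ (k + 2)).mono (n' := 4) (by omega) le_rfl) le_rfl).mono (n' := 4) (e' := 2)
        (by norm_num) (by norm_num)).div_id.div_id.div_one_add_sq).mono le_rfl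
          (by norm_num)).congr fun x _ => by field_simp
  exact (((((((((t1.sub t2).add t3).add t4).sub t5).sub t6).add t7).add t8).add t9).add
    t10).const_mul (3 / 2)

/-- Here `t1` and `t2` set the exponent `-5`; the convolution terms reach `-8` or less. -/
theorem LowerReg.reg_lapseRHS (h : LowerReg m S J) (hJ : 2 ≤ J) (ρ σ : ℕ → ℝ) :
    Reg 1 (-5) (lapseRHS ρ σ m S J) := by
  have hG : ∀ k, 2 ≤ k → k < J → Reg 2 (-4) (GC σ k) :=
    fun k hk _ => (reg_GC σ k).mono hk le_rfl
  have hM : ∀ k, 2 ≤ k → k < J → Reg 0 1 (MTilde m S k) := fun k hk hkJ => h.reg_MTilde hk hkJ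
  have t1 : Reg 1 (-5) fun x => 2 / x * GC σ J x :=
    (((reg_GC σ J).mono (n' := 2) hJ le_rfl).div_id.const_mul 2).congr fun x _ => by ring
  have t2 : Reg 1 (-5) fun x => zetaC ρ σ J x / (2 * x * (1 + x ^ 2) ^ 2) :=
    ((((reg_zetaC ρ σ J).mono (n' := 2) hJ le_rfl).div_id.div_one_add_sq.div_one_add_sq).const_mul
      (1 / 2)).congr fun x _ => by field_simp
  have t3 : Reg 1 (-5) fun x =>
      2 / (x * (1 + x ^ 2) ^ 2) * conv (GC σ) (MTilde m S) J x :=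
    (((((reg_conv hG hM le_rfl).div_id.div_one_add_sq.div_one_add_sq).mono le_rfl
      (by norm_num)).const_mul 2).congr fun x _ => by field_simp)
  have t4 : Reg 1 (-5) fun x => 2 / x * conv (GC σ) S J x :=
    (((reg_conv hG h.lapse le_rfl).div_id.mono le_rfl (by norm_num)).const_mul 2).congr
      fun x _ => by ring
  have t5 : Reg 1 (-5) fun x =>
      2 / (x * (1 + x ^ 2) ^ 2) * conv (conv (GC σ) S) (MTilde m S) J x :=
    (((((reg_conv (fun i _ hi => reg_conv hG h.lapse hi.le) hM
      le_rfl).div_id.div_one_add_sq.div_one_add_sq).mono le_rfl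
        (by norm_num)).const_mul 2).congr fun x _ => by field_simp)
  have t6 : Reg 1 (-5) fun x =>
      1 / (1 + x ^ 2) ^ 2 * conv (MTilde m S) (fun k => deriv (S k)) J x :=
    (((reg_conv hM h.deriv_lapse le_rfl).div_one_add_sq.div_one_add_sq).mono (by norm_num)
      (by norm_num)).congr fun x _ => by field_simp
  exact ((((t1.add t2).add t3).add t4).add t5).sub t6

end

/-! ### Integration of functions with prescribed orders -/

theorem Reg.integrableOn {n : ℕ} {e : ℤ} {f : ℝ → ℝ} (h : Reg n e f) (he : e ≤ -2) :
    IntegrableOn f (Ioi 0) := by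
  obtain ⟨⟨s, hs, hfs⟩, hO⟩ := h
  have hc : Continuous fun x => x ^ n * s x := (continuous_pow n).mul hs.continuous
  have hO' : (fun x => x ^ n * s x) =O[atTop] fun x : ℝ => x ^ (-2 : ℝ) := by
    refine (hO.trans (zpow_isBigO_zpow he)).congr' ?_ ?_
    · filter_upwards [eventually_gt_atTop 0] with x hx using hfs x hx
    · filter_upwards [eventually_gt_atTop 0] with x hx
      exact_mod_cast (Real.rpow_intCast x (-2)).symm
  -- `f` is uncontrolled at 0 itself, so integrability is proved for its continuous representative
  -- on `[0, ∞)`.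
  have hI : IntegrableOn (fun x => x ^ n * s x) (Ici 0) :=
    (hc.locallyIntegrable.locallyIntegrableOn _).integrableOn_of_isBigO_atTop hO'
      (integrableAtFilter_rpow_atTop_iff.2 (by norm_num))
  exact (hI.mono_set Ioi_subset_Ici_self).congr_fun (fun x hx => (hfs x hx).symm) measurableSet_Ioi

theorem isBigO_integral_Ioi {e : ℤ} (he : e ≤ -1) {f : ℝ → ℝ}
    (hf : f =O[atTop] fun x : ℝ => x ^ (e - 1)) :
    (fun x => ∫ t in Ioi x, f t) =O[atTop] fun x : ℝ => x ^ e := by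
  obtain ⟨C, hC⟩ := hf.bound
  obtain ⟨X, hX⟩ := eventually_atTop.1 hC
  have heR : (e : ℝ) ≤ -1 := by exact_mod_cast he
  have he0 : (e : ℝ) - 1 < -1 := by linarith
  -- The constant comes from `∫_x^∞ t^{e-1} dt = x^e / (-e)`.
  refine IsBigO.of_bound (C * (-(e : ℝ))⁻¹) ?_
  filter_upwards [eventually_ge_atTop X, eventually_gt_atTop 0] with x hxX hx
  have hb : ∀ t ∈ Ioi x, ‖f t‖ ≤ C * t ^ ((e : ℝ) - 1) := fun t ht => by
    have ht' : x < t := ht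
    have h := hX t (hxX.trans ht'.le)
    rw [Real.norm_of_nonneg (zpow_nonneg (hx.trans ht').le _)] at h
    refine h.trans_eq ?_
    rw [← Real.rpow_intCast]
    push_cast
    rfl
  refine (norm_integral_le_of_norm_le ((integrableOn_Ioi_rpow_of_lt he0 hx).const_mul C)
    ((ae_restrict_iff' measurableSet_Ioi).2 (Eventually.of_forall hb))).trans_eq ?_
  rw [integral_const_mul, integral_Ioi_rpow_of_lt he0 hx, sub_add_cancel, Real.rpow_intCast,
    Real.norm_of_nonneg (zpow_nonneg hx.le _), neg_div, ← div_neg, div_eq_inv_mul, mul_assoc]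

theorem Reg.primitive {n : ℕ} {e : ℤ} {f : ℝ → ℝ} (h : Reg n e f) :
    ∃ u : ℝ → ℝ, ContDiff ℝ ∞ u ∧
      (∀ x, 0 ≤ x → ∫ t in (0 : ℝ)..x, f t = x ^ (n + 1) * u x) ∧
      ∀ x, 0 < x → HasDerivAt (fun x => x ^ (n + 1) * u x) (f x) x := by
  obtain ⟨⟨s, hs, hfs⟩, -⟩ := h
  obtain ⟨u, hu, hus⟩ := exists_contDiff_integral_pow_mul n hs
  refine ⟨u, hu, fun x hx => ?_, fun x hx => ?_⟩
  · rw [← hus x]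
    refine intervalIntegral.integral_congr_ae (Eventually.of_forall fun t ht => ?_)
    rw [uIoc_of_le hx] at ht
    exact hfs t ht.1
  · simp only [← hus]
    rw [hfs x hx]
    exact (((continuous_pow n).mul hs.continuous).integral_hasStrictDerivAt 0 x).hasDerivAt

theorem mass_spec {f m : ℝ → ℝ} (hf : Reg 2 (-2) f)
    (hm : ∀ x, 0 ≤ x → m x = ∫ t in (0 : ℝ)..x, f t) :
    (∃ u : ℝ → ℝ, ContDiff ℝ ∞ u ∧ ∀ x, 0 ≤ x → m x = x ^ 3 * u x) ∧
    (∀ x, 0 < x → HasDerivAt m (f x) x) ∧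
    ∃ M : ℝ, (fun x => m x - M) =O[atTop] fun x : ℝ => x ^ (-1 : ℤ) := by
  obtain ⟨u, hu, hus, hd⟩ := hf.primitive
  have hmu : ∀ x, 0 ≤ x → m x = x ^ 3 * u x := fun x hx => (hm x hx).trans (hus x hx)
  refine ⟨⟨u, hu, hmu⟩, fun x hx => (hd x hx).congr_of_eventuallyEq ?_,
    -- The limit `M` is the total integral, and `m - M` is minus the tail.
    ∫ t in Ioi 0, f t, ?_⟩
  · filter_upwards [Ioi_mem_nhds hx] with y hy using hmu y (le_of_lt hy)
  · refine (isBigO_integral_Ioi (e := -1) le_rfl hf.2).neg_left.congr' ?_ EventuallyEq.rfl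
    filter_upwards [eventually_ge_atTop 0] with x hx
    have hI := hf.integrableOn le_rfl
    rw [hm x hx, ← intervalIntegral.integral_interval_add_Ioi hI
      (hI.mono_set (Ioi_subset_Ioi hx))]
    ring

theorem lapse_spec {g S : ℝ → ℝ} (hg : Reg 1 (-5) g)
    (hS : ∀ x, 0 ≤ x → S x = -∫ t in Ioi x, g t) :
    (∃ u : ℝ → ℝ, ContDiff ℝ ∞ u ∧ ∀ x, 0 ≤ x → S x = S 0 + x ^ 2 * u x) ∧
    (∀ x, 0 < x → HasDerivAt S (g x) x) ∧ S =O[atTop] fun x : ℝ => x ^ (-4 : ℤ) := by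
  obtain ⟨u, hu, hus, hd⟩ := hg.primitive
  have hI := hg.integrableOn (by norm_num)
  have hSu : ∀ x, 0 ≤ x → S x = S 0 + x ^ 2 * u x := fun x hx => by
    rw [hS x hx, hS 0 le_rfl, ← hus x hx, ← intervalIntegral.integral_interval_add_Ioi hI
      (hI.mono_set (Ioi_subset_Ioi hx))]
    ring
  refine ⟨⟨u, hu, hSu⟩, fun x hx => ((hd x hx).const_add (S 0)).congr_of_eventuallyEq ?_, ?_⟩
  · filter_upwards [Ioi_mem_nhds hx] with y hy using hSu y (le_of_lt hy)
  · refine (isBigO_integral_Ioi (e := -4) (by norm_num) hg.2).neg_left.congr' ?_ EventuallyEq.rfl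
    filter_upwards [eventually_ge_atTop 0] with x hx using (hS x hx).symm

/-! ### The solution -/

/-- The pair `(m̂_j, Ŝ_j)`, obtained by integrating the right-hand sides built from the functions of
lower order. -/
noncomputable def sol (ρ σ : ℕ → ℝ) (j : ℕ) : (ℝ → ℝ) × (ℝ → ℝ) :=
  (fun x => ∫ t in (0 : ℝ)..x, massRHS ρ σ (fun k => if k < j then (sol ρ σ k).1 else 0)
      (fun k => if k < j then (sol ρ σ k).2 else 0) j t,
    fun x => -∫ t in Ioi x, lapseRHS ρ σ (fun k => if k < j then (sol ρ σ k).1 else 0)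
      (fun k => if k < j then (sol ρ σ k).2 else 0) j t)
  termination_by j

/-- The solution `m̂_j`. -/
noncomputable def massSol (ρ σ : ℕ → ℝ) (j : ℕ) : ℝ → ℝ := (sol ρ σ j).1

/-- The solution `Ŝ_j`. -/
noncomputable def lapseSol (ρ σ : ℕ → ℝ) (j : ℕ) : ℝ → ℝ := (sol ρ σ j).2

theorem integral_congr_Ioi {f g : ℝ → ℝ} (h : EqOn f g (Ioi 0)) {x : ℝ} (hx : 0 ≤ x) :
    ∫ t in (0 : ℝ)..x, f t = ∫ t in (0 : ℝ)..x, g t := by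
  refine intervalIntegral.integral_congr_ae (Eventually.of_forall fun t ht => h ?_)
  rw [uIoc_of_le hx] at ht
  exact ht.1

/-- The cutoff `if k < j` in `sol` serves termination only; by locality of the right-hand sides it
can be removed. -/
theorem sol_eq (ρ σ : ℕ → ℝ) (j : ℕ) {x : ℝ} (hx : 0 ≤ x) :
    massSol ρ σ j x = ∫ t in (0 : ℝ)..x, massRHS ρ σ (massSol ρ σ) (lapseSol ρ σ) j t ∧
      lapseSol ρ σ j x = -∫ t in Ioi x, lapseRHS ρ σ (massSol ρ σ) (lapseSol ρ σ) j t := by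
  have h := rhs_congr ρ σ (j := j) (m := fun k => if k < j then (sol ρ σ k).1 else 0)
    (S := fun k => if k < j then (sol ρ σ k).2 else 0) (m' := massSol ρ σ) (S' := lapseSol ρ σ)
    (fun k _ hk => by simp only [if_pos hk]; exact ⟨fun _ _ => rfl, fun _ _ => rfl⟩)
  constructor
  · rw [← integral_congr_Ioi h.1 hx, massSol, sol]
  · rw [← setIntegral_congr_fun (s := Ioi x) measurableSet_Ioi (h.2.mono (Ioi_subset_Ioi hx)), lapseSol, sol]

theorem reg_sol_of_lowerReg {ρ σ : ℕ → ℝ} {j : ℕ} (hj : 2 ≤ j)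
    (h : LowerReg (massSol ρ σ) (lapseSol ρ σ) j) :
    Reg 3 0 (massSol ρ σ j) ∧ Reg 0 (-4) (lapseSol ρ σ j) ∧
      Reg 2 (-2) (deriv (massSol ρ σ j)) ∧ Reg 1 (-5) (deriv (lapseSol ρ σ j)) := by
  have hf := h.reg_massRHS hj ρ σ
  have hg := h.reg_lapseRHS hj ρ σ
  obtain ⟨⟨u, hu, hmu⟩, hdm, M, hM⟩ := mass_spec hf fun x hx => (sol_eq ρ σ j hx).1
  obtain ⟨⟨v, hv, hSv⟩, hdS, hS⟩ := lapse_spec hg fun x hx => (sol_eq ρ σ j hx).2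
  refine ⟨⟨⟨u, hu, fun x hx => hmu x hx.le⟩, ?_⟩,
    ⟨⟨fun x => lapseSol ρ σ j 0 + x ^ 2 * v x, by fun_prop, fun x hx => ?_⟩, hS⟩,
    hf.congr fun x hx => (hdm x hx).deriv, hg.congr fun x hx => (hdS x hx).deriv⟩
  -- A nonzero limit `M` is allowed, so the mass functions are only bounded: exponent 0.
  · have h0 : (fun _ : ℝ => M) =O[atTop] fun x : ℝ => x ^ (0 : ℤ) := by
      simpa using isBigO_const_const M (one_ne_zero (α := ℝ)) (atTop : Filter ℝ)
    simpa using (hM.trans (zpow_isBigO_zpow (by norm_num))).add h0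
  · rw [hSv x hx.le, pow_zero, one_mul]

theorem lowerReg_sol (ρ σ : ℕ → ℝ) (J : ℕ) : LowerReg (massSol ρ σ) (lapseSol ρ σ) J := by
  induction J with
  | zero => exact ⟨fun k _ hk => absurd hk k.not_lt_zero, fun k _ hk => absurd hk k.not_lt_zero,
      fun k _ hk => absurd hk k.not_lt_zero, fun k _ hk => absurd hk k.not_lt_zero⟩
  | succ J ih =>
    have key : ∀ k, 2 ≤ k → k < J + 1 → Reg 3 0 (massSol ρ σ k) ∧ Reg 0 (-4) (lapseSol ρ σ k) ∧
        Reg 2 (-2) (deriv (massSol ρ σ k)) ∧ Reg 1 (-5) (deriv (lapseSol ρ σ k)) := by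
      intro k hk hkJ
      rcases Nat.lt_succ_iff_lt_or_eq.1 hkJ with h | rfl
      · exact ⟨ih.mass k hk h, ih.lapse k hk h, ih.deriv_mass k hk h, ih.deriv_lapse k hk h⟩
      · exact reg_sol_of_lowerReg hk ih
    exact ⟨fun k hk h => (key k hk h).1, fun k hk h => (key k hk h).2.1,
      fun k hk h => (key k hk h).2.2.1, fun k hk h => (key k hk h).2.2.2⟩

theorem reg_massRHS_sol (ρ σ : ℕ → ℝ) {j : ℕ} (hj : 2 ≤ j) :
    Reg 2 (-2) (massRHS ρ σ (massSol ρ σ) (lapseSol ρ σ) j) :=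
  (lowerReg_sol ρ σ j).reg_massRHS hj ρ σ

theorem reg_lapseRHS_sol (ρ σ : ℕ → ℝ) {j : ℕ} (hj : 2 ≤ j) :
    Reg 1 (-5) (lapseRHS ρ σ (massSol ρ σ) (lapseSol ρ σ) j) :=
  (lowerReg_sol ρ σ j).reg_lapseRHS hj ρ σ

theorem contDiffOn_sol (ρ σ : ℕ → ℝ) {j : ℕ} (hj : 2 ≤ j) :
    ContDiffOn ℝ ∞ (massSol ρ σ j) (Ici 0) ∧ ContDiffOn ℝ ∞ (lapseSol ρ σ j) (Ici 0) := by
  obtain ⟨⟨u, hu, hmu⟩, -⟩ :=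
    mass_spec (reg_massRHS_sol ρ σ hj) fun x hx => (sol_eq ρ σ j hx).1
  obtain ⟨⟨v, hv, hSv⟩, -⟩ :=
    lapse_spec (reg_lapseRHS_sol ρ σ hj) fun x hx => (sol_eq ρ σ j hx).2
  have hm : ContDiff ℝ ∞ fun x => x ^ 3 * u x := by fun_prop
  have hS : ContDiff ℝ ∞ fun x => lapseSol ρ σ j 0 + x ^ 2 * v x := by fun_prop
  exact ⟨hm.contDiffOn.congr hmu, hS.contDiffOn.congr hSv⟩

theorem solvesOrder_sol (ρ σ : ℕ → ℝ) {j : ℕ} (hj : 2 ≤ j) :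
    SolvesOrder ρ σ (massSol ρ σ) (lapseSol ρ σ) j where
  mass_cont := (contDiffOn_sol ρ σ hj).1.continuousOn
  lapse_cont := (contDiffOn_sol ρ σ hj).2.continuousOn
  mass_ode := (mass_spec (reg_massRHS_sol ρ σ hj) fun _ hx => (sol_eq ρ σ j hx).1).2.1
  lapse_ode := (lapse_spec (reg_lapseRHS_sol ρ σ hj) fun _ hx => (sol_eq ρ σ j hx).2).2.1
  mass_zero := by rw [(sol_eq ρ σ j le_rfl).1, intervalIntegral.integral_same]
  lapse_infty :=
    (lapse_spec (reg_lapseRHS_sol ρ σ hj) fun _ hx => (sol_eq ρ σ j hx).2).2.2.trans_tendsto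
      (tendsto_zpow_atTop_zero (by norm_num))

/-- Once the lower orders agree, both families have the same right-hand side at order `j`. The
boundary condition at 0 fixes the mass function and the one at infinity the lapse function. As the
equations hold only for `x > 0`, continuity at 0 is what lets the integration start there. -/
theorem sol_unique (ρ σ : ℕ → ℝ) {J : ℕ} {m S : ℕ → ℝ → ℝ}
    (h : ∀ j, 2 ≤ j → j ≤ J → SolvesOrder ρ σ m S j) (j : ℕ) (hj : 2 ≤ j) (hjJ : j ≤ J) :
    EqOn (m j) (massSol ρ σ j) (Ici 0) ∧ EqOn (S j) (lapseSol ρ σ j) (Ici 0) := by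
  induction j using Nat.strong_induction_on with
  | _ j ih =>
    have hs := h j hj hjJ
    have hloc := rhs_congr ρ σ (j := j) (m := m) (S := S) fun k hk hkj =>
      ⟨(ih k hkj hk (by omega)).1.mono Ioi_subset_Ici_self,
        (ih k hkj hk (by omega)).2.mono Ioi_subset_Ici_self⟩
    have hIm := ((reg_massRHS_sol ρ σ hj).integrableOn le_rfl).congr_fun hloc.1.symm
      measurableSet_Ioi
    have hIS := ((reg_lapseRHS_sol ρ σ hj).integrableOn (by norm_num)).congr_fun hloc.2.symm
      measurableSet_Ioi
    refine ⟨fun x hx => ?_, fun x hx => ?_⟩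
    · have hx0 : 0 ≤ x := hx
      rw [(sol_eq ρ σ j hx0).1, ← integral_congr_Ioi hloc.1 hx0,
        intervalIntegral.integral_eq_sub_of_hasDerivAt_of_le hx0
          (hs.mass_cont.mono Icc_subset_Ici_self) (fun t ht => hs.mass_ode t ht.1)
          ((intervalIntegrable_iff_integrableOn_Ioc_of_le hx0).2
            (hIm.mono_set Ioc_subset_Ioi_self)), hs.mass_zero, sub_zero]
    · have hx0 : 0 ≤ x := hx
      rw [(sol_eq ρ σ j hx0).2, ← setIntegral_congr_fun (s := Ioi x) measurableSet_Ioi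
        (hloc.2.mono (Ioi_subset_Ioi hx0)), integral_Ioi_of_hasDerivAt_of_tendsto
          ((hs.lapse_cont x hx).mono (Ici_subset_Ici.2 hx0))
          (fun t ht => hs.lapse_ode t (lt_of_le_of_lt hx0 ht))
          (hIS.mono_set (Ioi_subset_Ioi hx0)) hs.lapse_infty]
      ring

/-! ### Estimates at the origin -/

theorem Reg.isBigO_zero {n : ℕ} {e : ℤ} {f : ℝ → ℝ} (h : Reg n e f) :
    f =O[𝓝[>] 0] fun x : ℝ => x ^ n := by
  obtain ⟨⟨s, hs, hfs⟩, -⟩ := h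
  have h1 : s =O[𝓝[>] 0] fun _ => (1 : ℝ) :=
    (hs.continuous.continuousAt.mono_left nhdsWithin_le_nhds).isBigO_one ℝ
  refine ((isBigO_refl (fun x : ℝ => x ^ n) _).mul h1).congr' ?_ (by simp)
  filter_upwards [self_mem_nhdsWithin] with x hx using (hfs x hx).symm

theorem isBigO_zero_of_eq_pow_mul {n : ℕ} {f u : ℝ → ℝ} (hu : Continuous u)
    (h : ∀ x, 0 ≤ x → f x = x ^ n * u x) : f =O[𝓝[≥] 0] fun x : ℝ => x ^ n := by
  have h1 : u =O[𝓝[≥] 0] fun _ => (1 : ℝ) :=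
    (hu.continuousAt.mono_left nhdsWithin_le_nhds).isBigO_one ℝ
  refine ((isBigO_refl (fun x : ℝ => x ^ n) _).mul h1).congr' ?_ (by simp)
  filter_upwards [self_mem_nhdsWithin] with x hx using (h x hx).symm

end EYM

theorem mainTheorem5 (ρ σ : ℕ → ℝ) :
    -- the equations of lowest order
    (∀ (m S : ℕ → ℝ → ℝ) (x : ℝ), 0 < x →
      EYM.massRHS ρ σ m S 2 x =
          x ^ 2 / 8 * (deriv (fun y => y * EYM.rhoT ρ 1 y) x) ^ 2
            + x ^ 2 * EYM.rhoT ρ 1 x ^ 2 / (4 * (1 + x ^ 2))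
            + (1 + x ^ 2) * (deriv (fun y => y ^ 2 * EYM.sigmaT σ 2 y) x) ^ 2
            + 2 * x ^ 2 * EYM.sigmaT σ 2 x ^ 2 ∧
      EYM.lapseRHS ρ σ m S 2 x =
          4 / (3 * x) * (deriv (fun y => y ^ 2 * EYM.sigmaT σ 2 y) x) ^ 2
            + x * EYM.rhoT ρ 1 x ^ 2 / (3 * (1 + x ^ 2) ^ 2)) ∧
    -- the right-hand sides of order `j` involve only the metric functions of lower order
    (∀ (j : ℕ) (m S m' S' : ℕ → ℝ → ℝ), 2 ≤ j →
      (∀ k, 2 ≤ k → k < j → Set.EqOn (m k) (m' k) (Set.Ioi 0) ∧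
        Set.EqOn (S k) (S' k) (Set.Ioi 0)) →
      Set.EqOn (EYM.massRHS ρ σ m S j) (EYM.massRHS ρ σ m' S' j) (Set.Ioi 0) ∧
        Set.EqOn (EYM.lapseRHS ρ σ m S j) (EYM.lapseRHS ρ σ m' S' j) (Set.Ioi 0)) ∧
    ∃ m S : ℕ → ℝ → ℝ,
      -- solvability at every order
      (∀ j, 2 ≤ j → EYM.SolvesOrder ρ σ m S j) ∧
      -- uniqueness, also for the system truncated at order `J`
      (∀ (J : ℕ) (m' S' : ℕ → ℝ → ℝ),
        (∀ j, 2 ≤ j → j ≤ J → EYM.SolvesOrder ρ σ m' S' j) →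
        ∀ j, 2 ≤ j → j ≤ J →
          Set.EqOn (m' j) (m j) (Set.Ici 0) ∧ Set.EqOn (S' j) (S j) (Set.Ici 0)) ∧
      ∀ j, 2 ≤ j →
        -- the solution is obtained by integration
        (MeasureTheory.IntegrableOn (EYM.massRHS ρ σ m S j) (Set.Ioi 0) ∧
          MeasureTheory.IntegrableOn (EYM.lapseRHS ρ σ m S j) (Set.Ioi 0) ∧
          ∀ x : ℝ, 0 ≤ x →
            m j x = ∫ t in (0 : ℝ)..x, EYM.massRHS ρ σ m S j t ∧
            S j x = - ∫ t in Set.Ioi x, EYM.lapseRHS ρ σ m S j t) ∧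
        -- global regularity
        ContDiffOn ℝ ∞ (m j) (Set.Ici 0) ∧
        ContDiffOn ℝ ∞ (S j) (Set.Ici 0) ∧
        -- behaviour at the origin
        (m j) =O[𝓝[≥] 0] (fun x : ℝ => x ^ 3) ∧
        (fun x => S j x - S j 0) =O[𝓝[≥] 0] (fun x : ℝ => x ^ 2) ∧
        (deriv (m j)) =O[𝓝[>] 0] (fun x : ℝ => x ^ 2) ∧
        (deriv (S j)) =O[𝓝[>] 0] (fun x : ℝ => x) ∧
        -- behaviour at infinity
        (∃ M : ℝ, (fun x => m j x - M) =O[atTop] (fun x : ℝ => x ^ (-1 : ℤ))) ∧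
        (S j) =O[atTop] (fun x : ℝ => x ^ (-4 : ℤ)) ∧
        (deriv (m j)) =O[atTop] (fun x : ℝ => x ^ (-2 : ℤ)) ∧
        (deriv (S j)) =O[atTop] (fun x : ℝ => x ^ (-5 : ℤ)) := by
  refine ⟨fun m S x hx => ⟨EYM.massRHS_two ρ σ m S hx, EYM.lapseRHS_two ρ σ m S hx⟩,
    fun j m S m' S' _ h => EYM.rhs_congr ρ σ h,
    EYM.massSol ρ σ, EYM.lapseSol ρ σ, fun j hj => EYM.solvesOrder_sol ρ σ hj,
    fun J m' S' h => EYM.sol_unique ρ σ h, fun j hj => ?_⟩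
  have hf := EYM.reg_massRHS_sol ρ σ hj
  have hg := EYM.reg_lapseRHS_sol ρ σ hj
  -- `LowerReg` covers orders strictly below its index, so order `j` needs `j + 1`.
  have hl := EYM.lowerReg_sol ρ σ (j + 1)
  have hdm := hl.deriv_mass j hj (Nat.lt_succ_self j)
  have hdS := hl.deriv_lapse j hj (Nat.lt_succ_self j)
  obtain ⟨⟨u, hu, hmu⟩, -, hM⟩ := EYM.mass_spec hf fun x hx => (EYM.sol_eq ρ σ j hx).1
  obtain ⟨⟨v, hv, hSv⟩, -, hS⟩ := EYM.lapse_spec hg fun x hx => (EYM.sol_eq ρ σ j hx).2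
  refine ⟨⟨hf.integrableOn le_rfl, hg.integrableOn (by norm_num), fun x hx => EYM.sol_eq ρ σ j hx⟩,
    (EYM.contDiffOn_sol ρ σ hj).1, (EYM.contDiffOn_sol ρ σ hj).2,
    EYM.isBigO_zero_of_eq_pow_mul hu.continuous hmu,
    EYM.isBigO_zero_of_eq_pow_mul hv.continuous fun x hx => by rw [hSv x hx]; ring,
    hdm.isBigO_zero, by simpa using hdS.isBigO_zero, hM, hS, hdm.2, hdS.2⟩
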